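/- **Theorem 3.2.** Let $n=1+n_1+n_2$ with $n_1,n_2\ge 1$, let $M^n$ be a smooth manifold and let $\psi:M^n\to\mathbb R^{n+1}$ be a locally strongly convex centroaffine hypersurface, i.e. a smooth immersion whose position vector is everywhere transversal to the tangent plane and for which there is $\varepsilon\in\{1,-1\}$ such that the centroaffine metric $h$ in the Gauss formula $$D_X\psi_*(Y)=\psi_*(\nabla_XY)+h(X,Y)(-\varepsilon\psi)$$ is positive definite ($D$ is the standard flat connection). Let $\hat\nabla$ be the Levi-Civita connection of $h$ and $K(X,Y)=\nabla_XY-\hat\nabla_XY$ the difference tensor. Assume that $\hat\nabla K=0$ and that there are a smooth vector field $T$ with $h(T,T)=1$ and distributions $\mathcal D_2,\mathcal D_3$ of dimensions $n_1,n_2$ such that $\mathcal D_1=\mathbb R T$, $\mathcal D_2$ and $\mathcal D_3$ are mutually $h$-orthogonal, and constants $\lambda_1,\lambda_2,\lambda_3$ with $$K(T,T)=\lambda_1T,\quad K(T,V)=\lambda_2V,\quad K(T,W)=\lambda_3W\qquad(V\in\mathcal D_2,\ W\in\mathcal D_3),$$ $$\lambda_1\ne2\lambda_2,\quad \lambda_1\ne2\lambda_3,\quad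 \lambda_2\ne\lambda_3.$$ Then $\psi$ is locally the Calabi product of two locally strongly convex centroaffine hypersurfaces $\psi_1:M_1^{n_1}\to\mathbb R^{n_1+1}$ and $\psi_2:M_2^{n_2}\to\mathbb R^{n_2+1}$ with parallel cubic form. That is, there is a constant $\lambda\ne0,-1$ such that every point of $M$ has an open neighbourhood diffeomorphic to some $J\times M_1\times M_2$, with $J\subseteq\mathbb R$ open and $M_i\subseteq\mathbb R^{n_i}$ open, on which, after a linear identification $\mathbb R^{n+1}\cong\mathbb R^{n_1+1}\times\mathbb R^{n_2+1}$, $$\psi(u,p,q)=\bigl(e^{u}\psi_1(p),\,e^{-\lambda u}\psi_2(q)\bigr),$$ where each $\psi_i$ is a locally strongly convex centroaffine hypersurface whose cubic form $C^i=\nabla^ih^i$ is parallel with respect to the Levi-Civita connection $\hat\nabla^i$ of its centroaffine metric $h^i$ (the sign $\varepsilon_i=\pm1$ being chosen so that $h^i$ is positive definite). -/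

import Mathlib

open scoped Manifold ContDiff

namespace Centroaffine

/-- The standard space `ℝⁿ`. -/
abbrev Euc (n : ℕ) : Type := EuclideanSpace ℝ (Fin n)

/-! ### Centroaffine invariants of a local parametrization `F` of a hypersurface of `ℝⁿ⁺¹`

`F` is considered near the point `x : ℝⁿ`; tangent vectors are written in the coordinates of `ℝⁿ`,
and the arguments `u v w z` are tangent vectors (constant coordinate vector fields). -/

noncomputable section LocalInvariants

variable {n : ℕ}

/-- The map `(v, c) ↦ dF(v) + c • (-ε F)` at `x`. It is an isomorphism `ℝⁿ × ℝ ≃ ℝⁿ⁺¹` exactly when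
`F` is immersed at `x` and its position vector is transversal to the tangent plane (`ε = ±1`). -/
def gaussFrame (ε : ℝ) (F : Euc n → Euc (n + 1)) (x : Euc n) : Euc n × ℝ →L[ℝ] Euc (n + 1) :=
  (fderiv ℝ F x).coprod (ContinuousLinearMap.toSpanSingleton ℝ (-(ε • F x)))

/-- The centroaffine metric `h`: the component of the second derivative of `F` along `-ε F` in the
Gauss formula `D_u dF(v) = dF(Γ(u, v)) + h(u, v) (-ε F)`. -/
def metric (ε : ℝ) (F : Euc n → Euc (n + 1)) (x : Euc n) : Euc n →L[ℝ] Euc n →L[ℝ] ℝ :=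
  (ContinuousLinearMap.compL ℝ (Euc n) (Euc (n + 1)) ℝ
    ((ContinuousLinearMap.snd ℝ (Euc n) ℝ).comp (gaussFrame ε F x).inverse)).comp
    (fderiv ℝ (fderiv ℝ F) x)

/-- The Christoffel symbol `Γ` of the induced connection `∇`: the tangential component of the second
derivative of `F` in the Gauss formula. Thus `∇_X Y = D_X Y + Γ(X, Y)` in coordinates. -/
def inducedConnection (ε : ℝ) (F : Euc n → Euc (n + 1)) (x : Euc n) :
    Euc n →L[ℝ] Euc n →L[ℝ] Euc n :=
  (ContinuousLinearMap.compL ℝ (Euc n) (Euc (n + 1)) (Euc n)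
    ((ContinuousLinearMap.fst ℝ (Euc n) ℝ).comp (gaussFrame ε F x).inverse)).comp
    (fderiv ℝ (fderiv ℝ F) x)

/-- The Christoffel symbol `Γ̂` of the Levi-Civita connection of a metric `g`, given by
`2 g(Γ̂(u, v), w) = ∂_u g(v, w) + ∂_v g(u, w) - ∂_w g(u, v)`. -/
def leviCivita (g : Euc n → Euc n →L[ℝ] Euc n →L[ℝ] ℝ) (x u v : Euc n) : Euc n :=
  (g x).inverse ((1 / 2 : ℝ) •
    (fderiv ℝ g x u v + fderiv ℝ g x v u - ((fderiv ℝ g x).flip u).flip v))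

/-- The Levi-Civita connection `∇̂` of the centroaffine metric. -/
def metricConnection (ε : ℝ) (F : Euc n → Euc (n + 1)) (x u v : Euc n) : Euc n :=
  leviCivita (metric ε F) x u v

/-- The difference tensor `K(u, v) = ∇_u v - ∇̂_u v`. -/
def differenceTensor (ε : ℝ) (F : Euc n → Euc (n + 1)) (x u v : Euc n) : Euc n :=
  inducedConnection ε F x u v - metricConnection ε F x u v

/-- `(∇̂_u K)(v, w) = ∇̂_u (K(v, w)) - K(∇̂_u v, w) - K(v, ∇̂_u w)`. -/
def covDerivDifferenceTensor (ε : ℝ) (F : Euc n → Euc (n + 1)) (x u v w : Euc n) : Euc n :=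
  fderiv ℝ (fun y => differenceTensor ε F y v w) x u
    + metricConnection ε F x u (differenceTensor ε F x v w)
    - differenceTensor ε F x (metricConnection ε F x u v) w
    - differenceTensor ε F x v (metricConnection ε F x u w)

/-- The cubic form `C = ∇h`, `C(u, v, w) = u(h(v, w)) - h(∇_u v, w) - h(v, ∇_u w)`. -/
def cubicForm (ε : ℝ) (F : Euc n → Euc (n + 1)) (x u v w : Euc n) : ℝ :=
  fderiv ℝ (fun y => metric ε F y v w) x u
    - metric ε F x (inducedConnection ε F x u v) w
    - metric ε F x v (inducedConnection ε F x u w)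

/-- `(∇̂_u C)(v, w, z) = u(C(v, w, z)) - C(∇̂_u v, w, z) - C(v, ∇̂_u w, z) - C(v, w, ∇̂_u z)`. -/
def covDerivCubicForm (ε : ℝ) (F : Euc n → Euc (n + 1)) (x u v w z : Euc n) : ℝ :=
  fderiv ℝ (fun y => cubicForm ε F y v w z) x u
    - cubicForm ε F x (metricConnection ε F x u v) w z
    - cubicForm ε F x v (metricConnection ε F x u w) z
    - cubicForm ε F x v w (metricConnection ε F x u z)

end LocalInvariants

/-! ### Centroaffine hypersurfaces `ψ : Mⁿ → ℝⁿ⁺¹`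

Tensors on `M` are read in the charts of the atlas; the conditions below are tensorial, so they do
not depend on the charts. -/

noncomputable section Hypersurfaces

variable {n : ℕ} {M : Type*} [TopologicalSpace M] [ChartedSpace (Euc n) M]

/-- `ψ` is a centroaffine hypersurface: a smooth immersion whose position vector is everywhere
transversal to the tangent plane. -/
structure IsCentroaffine (ψ : M → Euc (n + 1)) : Prop where
  smooth : ContMDiff (𝓡 n) (𝓡 (n + 1)) ∞ ψ
  immersion : ∀ p : M, Function.Injective (mfderiv (𝓡 n) (𝓡 (n + 1)) ψ p)
  transversal : ∀ p : M, ψ p ∉ Set.range (mfderiv (𝓡 n) (𝓡 (n + 1)) ψ p)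

/-- The centroaffine metric `h` of `ψ` on tangent vectors at `p`, computed in the chart `e`. -/
def metricAt (ε : ℝ) (ψ : M → Euc (n + 1)) (e : OpenPartialHomeomorph M (Euc n)) (p : M)
    (v w : TangentSpace (𝓡 n) p) : ℝ :=
  metric ε (ψ ∘ e.symm) (e p) (mfderiv (𝓡 n) (𝓡 n) e p v) (mfderiv (𝓡 n) (𝓡 n) e p w)

/-- `K(v, w) = z` for the difference tensor `K` of `ψ` and tangent vectors `v w z` at `p`, computed
in the chart `e`. -/
def DifferenceTensorEq (ε : ℝ) (ψ : M → Euc (n + 1)) (e : OpenPartialHomeomorph M (Euc n)) (p : M)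
    (v w z : TangentSpace (𝓡 n) p) : Prop :=
  differenceTensor ε (ψ ∘ e.symm) (e p) (mfderiv (𝓡 n) (𝓡 n) e p v) (mfderiv (𝓡 n) (𝓡 n) e p w) =
    mfderiv (𝓡 n) (𝓡 n) e p z

/-- `ψ` is a locally strongly convex centroaffine hypersurface, and `ε = ±1` is the sign for which
the centroaffine metric induced by the centroaffine normal `-ε ψ` is positive definite. -/
structure IsLocallyStronglyConvex (ε : ℝ) (ψ : M → Euc (n + 1)) : Prop where
  centroaffine : IsCentroaffine ψ
  sign : ε = 1 ∨ ε = -1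
  pos : ∀ e ∈ atlas (Euc n) M, ∀ x ∈ e.target, ∀ v : Euc n, v ≠ 0 →
    0 < metric ε (ψ ∘ e.symm) x v v

/-- The difference tensor is parallel: `∇̂K = 0`. -/
def HasParallelDifferenceTensor (ε : ℝ) (ψ : M → Euc (n + 1)) : Prop :=
  ∀ e ∈ atlas (Euc n) M, ∀ x ∈ e.target, ∀ u v w : Euc n,
    covDerivDifferenceTensor ε (ψ ∘ e.symm) x u v w = 0

/-- The cubic form is parallel: `∇̂C = 0`. -/
def HasParallelCubicForm (ε : ℝ) (ψ : M → Euc (n + 1)) : Prop :=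
  ∀ e ∈ atlas (Euc n) M, ∀ x ∈ e.target, ∀ u v w z : Euc n,
    covDerivCubicForm ε (ψ ∘ e.symm) x u v w z = 0

end Hypersurfaces

/-- The (generalized) Calabi product `(u, p, q) ↦ (e^u ψ₁(p), e^{-λu} ψ₂(q))` of `ψ₁` and `ψ₂`. -/
noncomputable def calabiProduct {M₁ M₂ : Type*} {n₁ n₂ : ℕ} (lam : ℝ) (ψ₁ : M₁ → Euc (n₁ + 1))
    (ψ₂ : M₂ → Euc (n₂ + 1)) (u : ℝ) (p : M₁) (q : M₂) : Euc (n₁ + 1) × Euc (n₂ + 1) :=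
  (Real.exp u • ψ₁ p, Real.exp (-lam * u) • ψ₂ q)

/-- Near the point `x`, the hypersurface `ψ : M → ℝⁿ⁺¹` is the Calabi product, with parameter `lam`,
of two locally strongly convex centroaffine hypersurfaces with parallel cubic form, of dimensions
`n₁` and `n₂`: there are such hypersurfaces `ψᵢ : Uᵢ → ℝ^(nᵢ+1)` on coordinate domains `Uᵢ ⊆ ℝ^(nᵢ)`
and a diffeomorphism `Φ` of some `J × U₁ × U₂`, `J ⊆ ℝ` open, onto an open neighbourhood of `x` such
that, after a linear identification `A` of `ℝⁿ⁺¹` with `ℝ^(n₁+1) × ℝ^(n₂+1)`, `ψ ∘ Φ` is the Calabi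
product of `ψ₁` and `ψ₂`. -/
def IsCalabiProductNear {n : ℕ} {M : Type*} [TopologicalSpace M] [ChartedSpace (Euc n) M]
    (n₁ n₂ : ℕ) (lam : ℝ) (ψ : M → Euc (n + 1)) (x : M) : Prop :=
  ∃ (J : TopologicalSpace.Opens ℝ) (U₁ : TopologicalSpace.Opens (Euc n₁))
    (U₂ : TopologicalSpace.Opens (Euc n₂))
    (ψ₁ : U₁ → Euc (n₁ + 1)) (ψ₂ : U₂ → Euc (n₂ + 1)) (ε₁ ε₂ : ℝ)
    (A : Euc (n + 1) ≃L[ℝ] Euc (n₁ + 1) × Euc (n₂ + 1))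
    (Φ : OpenPartialHomeomorph (ℝ × Euc n₁ × Euc n₂) M),
    IsLocallyStronglyConvex ε₁ ψ₁ ∧ HasParallelCubicForm ε₁ ψ₁ ∧
    IsLocallyStronglyConvex ε₂ ψ₂ ∧ HasParallelCubicForm ε₂ ψ₂ ∧
    ContMDiffOn 𝓘(ℝ, ℝ × Euc n₁ × Euc n₂) (𝓡 n) ∞ Φ Φ.source ∧
    ContMDiffOn (𝓡 n) 𝓘(ℝ, ℝ × Euc n₁ × Euc n₂) ∞ Φ.symm Φ.target ∧
    x ∈ Φ.target ∧
    Φ.source = (J : Set ℝ) ×ˢ (U₁ : Set (Euc n₁)) ×ˢ (U₂ : Set (Euc n₂)) ∧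
    ∀ u ∈ J, ∀ (p : U₁) (q : U₂),
      A (ψ (Φ (u, (p : Euc n₁), (q : Euc n₂)))) = calabiProduct lam ψ₁ ψ₂ u p q

end Centroaffine

/-!
In a chart, write `F` for the parametrization and `τ` for the coordinate expression of `T`.
Differentiating `K(τ, τ) = λ₁ τ` and using `λ₁ ≠ 2 λ₂`, `λ₁ ≠ 2 λ₃` one finds that `τ` is parallel,
and the Codazzi equation then shows that `dF(τ)` solves the same linear Gauss equation as `F`. Hence
`dF(τ) = B ∘ F` for a constant endomorphism `B`, and the curvature identity `R̂(·, ·) τ = 0` gives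
`λ₁ = λ₂ + λ₃` and `λ₂ λ₃ = ε`, so that `B` is diagonalizable with eigenvalues `λ₂`, `λ₃` and
eigenspaces of dimensions `n₁ + 1` and `n₂ + 1`.

The form dual to `τ` is closed, say `dt`. If `A₁` and `A₂` are the projections onto the eigenspaces,
then `e^(-λ₂ t) A₁ F` has vanishing derivative along `τ` and `D₃`, and `e^(-λ₃ t) A₂ F` along `τ`
and `D₂`. With `u = λ₂ t` this is the Calabi product with `λ = -λ₃ / λ₂`. The two factors are the
images of integral manifolds of `D₂` and `D₃`. These are totally geodesic, and the image of a leaf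
of `D₂` has the centroaffine metric `|ε - λ₂²| h`, so its cubic form is a constant multiple of the
restriction of `h(K(·, ·), ·)` and is parallel.
-/

namespace Centroaffine

set_option maxSynthPendingDepth 5

section Calculus

variable {𝕜 E G V : Type*} [NontriviallyNormedField 𝕜]
  [NormedAddCommGroup E] [NormedSpace 𝕜 E] [NormedAddCommGroup G] [NormedSpace 𝕜 G]
  [NormedAddCommGroup V] [NormedSpace 𝕜 V]

theorem isInvertible_of_injective [CompleteSpace 𝕜] [FiniteDimensional 𝕜 E]
    [FiniteDimensional 𝕜 G] {f : E →L[𝕜] G} (hf : Function.Injective f)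
    (h : Module.finrank 𝕜 E = Module.finrank 𝕜 G) : f.IsInvertible :=
  ⟨(LinearEquiv.ofInjectiveOfFinrankEq (f : E →ₗ[𝕜] G) hf h).toContinuousLinearEquiv, rfl⟩

theorem hasFDerivAt_of_contDiffAt_infty {f : E → G} {x : E} (hf : ContDiffAt 𝕜 ∞ f x) :
    HasFDerivAt f (fderiv 𝕜 f x) x :=
  (hf.differentiableAt (by simp)).hasFDerivAt

theorem contDiffAt_infty_fderiv {f : E → G} {x : E} (hf : ContDiffAt 𝕜 ∞ f x) :
    ContDiffAt 𝕜 ∞ (fderiv 𝕜 f) x :=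
  hf.fderiv_right (by simp)

theorem hasFDerivAt_clm_apply_const {f : E → G →L[𝕜] V} {f' : E →L[𝕜] G →L[𝕜] V} {x : E}
    (hf : HasFDerivAt f f' x) (v : G) : HasFDerivAt (fun y => f y v) (f'.flip v) x :=
  (hf.clm_apply (hasFDerivAt_const v x)).congr_fderiv (by ext; simp)

theorem hasFDerivAt_unique_of_eqOn {f g : E → G} {f' g' : E →L[𝕜] G} {Ω : Set E} {x : E}
    (hf : HasFDerivAt f f' x) (hg : HasFDerivAt g g' x) (hΩ : IsOpen Ω) (hx : x ∈ Ω)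
    (h : Set.EqOn f g Ω) (u : E) : f' u = g' u :=
  DFunLike.congr_fun
    (hf.unique (hg.congr_of_eventuallyEq (h.eventuallyEq_of_mem (hΩ.mem_nhds hx)))) u

end Calculus

theorem fderiv_fderiv_comm {E G : Type*} [NormedAddCommGroup E] [NormedSpace ℝ E]
    [NormedAddCommGroup G] [NormedSpace ℝ G] {f : E → G} {x : E} (hf : ContDiffAt ℝ ∞ f x)
    (u v : E) : fderiv ℝ (fderiv ℝ f) x u v = fderiv ℝ (fderiv ℝ f) x v u :=
  (hf.isSymmSndFDerivAt
    (by simpa using (WithTop.coe_le_coe.2 le_top : ((2 : ℕ∞) : WithTop ℕ∞) ≤ ∞))).eq u v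

/-! ### The Gauss formula -/

noncomputable section GaussEquation

variable {n : ℕ}

theorem gaussFrame_apply (ε : ℝ) (f : Euc n → Euc (n + 1)) (x v : Euc n) (c : ℝ) :
    gaussFrame ε f x (v, c) = fderiv ℝ f x v + c • -(ε • f x) := by
  simp [gaussFrame]

theorem gaussFrame_apply_zero (ε : ℝ) (f : Euc n → Euc (n + 1)) (x v : Euc n) :
    gaussFrame ε f x (v, 0) = fderiv ℝ f x v := by
  simp [gaussFrame]

theorem isInvertible_gaussFrame {ε : ℝ} {f : Euc n → Euc (n + 1)} {x : Euc n}
    (h : ∀ v c, gaussFrame ε f x (v, c) = 0 → v = 0 ∧ c = 0) :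
    (gaussFrame ε f x).IsInvertible := by
  refine isInvertible_of_injective ((injective_iff_map_eq_zero _).2 ?_) (by simp)
  rintro ⟨v, c⟩ hvc
  exact Prod.mk_eq_zero.2 (h v c hvc)

theorem contDiffAt_gaussFrame (ε : ℝ) {f : Euc n → Euc (n + 1)} {x : Euc n}
    (hf : ContDiffAt ℝ ∞ f x) : ContDiffAt ℝ ∞ (gaussFrame ε f) x := by
  have h : ContDiffAt ℝ ∞ (fun y => (fderiv ℝ f y).comp (ContinuousLinearMap.fst ℝ (Euc n) ℝ) +
      (ContinuousLinearMap.toSpanSingletonLIE ℝ (Euc (n + 1)) (-(ε • f y))).comp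
        (ContinuousLinearMap.snd ℝ (Euc n) ℝ)) x := by
    refine ((contDiffAt_infty_fderiv hf).clm_comp contDiffAt_const).add
      (ContDiffAt.clm_comp ?_ contDiffAt_const)
    exact (ContinuousLinearMap.toSpanSingletonLIE ℝ (Euc (n + 1))).contDiff.contDiffAt.comp x
      (hf.const_smul ε).neg
  refine h.congr_of_eventuallyEq (Filter.Eventually.of_forall fun y => ?_)
  ext v <;> simp [gaussFrame]

theorem hasFDerivAt_gaussFrame_field {ε : ℝ} {f : Euc n → Euc (n + 1)} {x : Euc n}
    (hf : ContDiffAt ℝ ∞ f x) {Γ : Euc n →L[ℝ] Euc n →L[ℝ] Euc n} {h : Euc n →L[ℝ] Euc n →L[ℝ] ℝ}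
    (hG : ∀ u v, fderiv ℝ (fderiv ℝ f) x u v = gaussFrame ε f x (Γ u v, h u v))
    {ξ : Euc n → Euc n} {ξ' : Euc n →L[ℝ] Euc n} {c : Euc n → ℝ} {c' : Euc n →L[ℝ] ℝ}
    (hξ : HasFDerivAt ξ ξ' x) (hc : HasFDerivAt c c' x) :
    HasFDerivAt (fun y => gaussFrame ε f y (ξ y, c y)) ((gaussFrame ε f x).comp
      ((ξ' + Γ.flip (ξ x) - (c x * ε) • ContinuousLinearMap.id ℝ (Euc n)).prod
        (c' + h.flip (ξ x)))) x := by
  simp only [gaussFrame_apply]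
  refine (((hasFDerivAt_of_contDiffAt_infty (contDiffAt_infty_fderiv hf)).clm_apply hξ).add
    (hc.smul ((hasFDerivAt_of_contDiffAt_infty hf).const_smul ε).neg)).congr_fderiv ?_
  ext1 u
  simp only [add_apply, sub_apply, neg_apply, smul_apply, ContinuousLinearMap.comp_apply,
    ContinuousLinearMap.flip_apply, ContinuousLinearMap.smulRight_apply,
    ContinuousLinearMap.prod_apply, ContinuousLinearMap.id_apply, hG, gaussFrame_apply,
    Pi.neg_apply, Pi.smul_apply, map_add, map_sub, map_smul]
  module

theorem gauss_components {ε : ℝ} {f : Euc n → Euc (n + 1)} {x : Euc n}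
    (hx : (gaussFrame ε f x).IsInvertible) {u v z : Euc n} {s : ℝ}
    (h : fderiv ℝ (fderiv ℝ f) x u v = gaussFrame ε f x (z, s)) :
    metric ε f x u v = s ∧ inducedConnection ε f x u v = z := by
  simp [metric, inducedConnection, h, hx.inverse_apply_self]

theorem gauss_formula {ε : ℝ} {f : Euc n → Euc (n + 1)} {x : Euc n}
    (hx : (gaussFrame ε f x).IsInvertible) (u v : Euc n) :
    fderiv ℝ (fderiv ℝ f) x u v =
      gaussFrame ε f x (inducedConnection ε f x u v, metric ε f x u v) :=
  (hx.self_apply_inverse (fderiv ℝ (fderiv ℝ f) x u v)).symm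

/-- The Christoffel symbol `Γ̂` of the Levi-Civita connection of `g` as a bundled bilinear map, for
use in the differential calculus. -/
def christoffel (g : Euc n → Euc n →L[ℝ] Euc n →L[ℝ] ℝ) (x : Euc n) :
    Euc n →L[ℝ] Euc n →L[ℝ] Euc n :=
  (ContinuousLinearMap.compL ℝ (Euc n) (Euc n →L[ℝ] ℝ) (Euc n) (g x).inverse).comp
    ((1 / 2 : ℝ) • (fderiv ℝ g x + (fderiv ℝ g x).flip -
      (((ContinuousLinearMap.flipₗᵢ ℝ (Euc n) (Euc n) ℝ).toContinuousLinearEquiv :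
        _ →L[ℝ] _).comp (fderiv ℝ g x).flip)))

theorem christoffel_apply (g : Euc n → Euc n →L[ℝ] Euc n →L[ℝ] ℝ) (x u v : Euc n) :
    christoffel g x u v = leviCivita g x u v :=
  congrArg (g x).inverse rfl

/-- The difference tensor `K = ∇ - ∇̂` as a bundled bilinear map. -/
def difference (ε : ℝ) (F : Euc n → Euc (n + 1)) (x : Euc n) :
    Euc n →L[ℝ] Euc n →L[ℝ] Euc n :=
  inducedConnection ε F x - christoffel (metric ε F) x

theorem difference_apply (ε : ℝ) (F : Euc n → Euc (n + 1)) (x u v : Euc n) :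
    difference ε F x u v = differenceTensor ε F x u v := by
  simp [difference, differenceTensor, metricConnection, christoffel_apply]

theorem christoffel_metric_apply (ε : ℝ) (F : Euc n → Euc (n + 1)) (x u v : Euc n) :
    christoffel (metric ε F) x u v = metricConnection ε F x u v :=
  christoffel_apply _ x u v

theorem inducedConnection_eq (ε : ℝ) (F : Euc n → Euc (n + 1)) (x : Euc n) :
    inducedConnection ε F x = christoffel (metric ε F) x + difference ε F x := by
  simp [difference]

end GaussEquation

noncomputable section ConvexParametrization

variable {n : ℕ}

/-- `F` is, on the open set `Ω`, a smooth parametrization of a centroaffine hypersurface with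
positive definite centroaffine metric. -/
structure ConvexParam (ε : ℝ) (F : Euc n → Euc (n + 1)) (Ω : Set (Euc n)) : Prop where
  isOpen : IsOpen Ω
  smooth : ContDiffOn ℝ ∞ F Ω
  frame : ∀ x ∈ Ω, (gaussFrame ε F x).IsInvertible
  pos : ∀ x ∈ Ω, ∀ v, v ≠ 0 → 0 < metric ε F x v v

namespace ConvexParam

variable {ε : ℝ} {F : Euc n → Euc (n + 1)} {Ω : Set (Euc n)} (H : ConvexParam ε F Ω) {x : Euc n}
  (hx : x ∈ Ω)
include H

theorem mono {Ω' : Set (Euc n)} (hΩ' : IsOpen Ω') (h : Ω' ⊆ Ω) : ConvexParam ε F Ω' where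
  isOpen := hΩ'
  smooth := H.smooth.mono h
  frame x hx := H.frame x (h hx)
  pos x hx := H.pos x (h hx)

include hx

theorem sign_ne_zero : ε ≠ 0 := by
  rintro rfl
  have h : gaussFrame 0 F x (0, 1) = gaussFrame 0 F x 0 := by simp [gaussFrame_apply]
  simpa using (H.frame x hx).injective h

theorem contDiffAt : ContDiffAt ℝ ∞ F x :=
  H.smooth.contDiffAt (H.isOpen.mem_nhds hx)

theorem hasFDerivAt : HasFDerivAt F (fderiv ℝ F x) x :=
  hasFDerivAt_of_contDiffAt_infty (H.contDiffAt hx)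

theorem contDiffAt_fderiv : ContDiffAt ℝ ∞ (fderiv ℝ F) x :=
  contDiffAt_infty_fderiv (H.contDiffAt hx)

theorem contDiffAt_frame_inverse : ContDiffAt ℝ ∞ (fun y => (gaussFrame ε F y).inverse) x :=
  (H.frame x hx).contDiffAt_map_inverse.comp x (contDiffAt_gaussFrame ε (H.contDiffAt hx))

theorem contDiffAt_metric : ContDiffAt ℝ ∞ (metric ε F) x := by
  refine ContDiffAt.clm_comp ?_ (contDiffAt_infty_fderiv (H.contDiffAt_fderiv hx))
  exact (ContinuousLinearMap.contDiff _).contDiffAt.comp x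
    (contDiffAt_const.clm_comp (H.contDiffAt_frame_inverse hx))

theorem contDiffAt_inducedConnection : ContDiffAt ℝ ∞ (inducedConnection ε F) x := by
  refine ContDiffAt.clm_comp ?_ (contDiffAt_infty_fderiv (H.contDiffAt_fderiv hx))
  exact (ContinuousLinearMap.contDiff _).contDiffAt.comp x
    (contDiffAt_const.clm_comp (H.contDiffAt_frame_inverse hx))

theorem hasFDerivAt_metric : HasFDerivAt (metric ε F) (fderiv ℝ (metric ε F) x) x :=
  hasFDerivAt_of_contDiffAt_infty (H.contDiffAt_metric hx)

theorem eq_zero_of_metric_self {v : Euc n} (h : metric ε F x v v = 0) : v = 0 := by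
  by_contra hv
  exact (H.pos x hx v hv).ne' h

theorem isInvertible_metric : (metric ε F x).IsInvertible := by
  refine isInvertible_of_injective ((injective_iff_map_eq_zero _).2 fun v hv => ?_) ?_
  · exact H.eq_zero_of_metric_self hx (by simp [hv])
  · rw [← LinearMap.toContinuousLinearMap.finrank_eq, Module.finrank_linearMap]
    simp

theorem eq_of_metric_eq {v w : Euc n} (h : ∀ z, metric ε F x v z = metric ε F x w z) : v = w :=
  (H.isInvertible_metric hx).injective (ContinuousLinearMap.ext h)

theorem contDiffAt_christoffel : ContDiffAt ℝ ∞ (christoffel (metric ε F)) x := by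
  have hd := contDiffAt_infty_fderiv (H.contDiffAt_metric hx)
  have hflip : ContDiffAt ℝ ∞ (fun y => (fderiv ℝ (metric ε F) y).flip) x :=
    (ContinuousLinearMap.flipₗᵢ ℝ (Euc n) (Euc n) (Euc n →L[ℝ] ℝ)).contDiff.contDiffAt.comp x hd
  refine ContDiffAt.clm_comp ?_
    (((hd.add hflip).sub (contDiffAt_const.clm_comp hflip)).const_smul _)
  exact (ContinuousLinearMap.contDiff _).contDiffAt.comp x
    ((H.isInvertible_metric hx).contDiffAt_map_inverse.comp x (H.contDiffAt_metric hx))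

theorem contDiffAt_difference : ContDiffAt ℝ ∞ (difference ε F) x :=
  (H.contDiffAt_inducedConnection hx).sub (H.contDiffAt_christoffel hx)

theorem hasFDerivAt_difference : HasFDerivAt (difference ε F) (fderiv ℝ (difference ε F) x) x :=
  hasFDerivAt_of_contDiffAt_infty (H.contDiffAt_difference hx)

theorem metric_comm (v w : Euc n) : metric ε F x v w = metric ε F x w v := by
  simp [metric, fderiv_fderiv_comm (H.contDiffAt hx) v w]

theorem inducedConnection_comm (v w : Euc n) :
    inducedConnection ε F x v w = inducedConnection ε F x w v := by
  simp [inducedConnection, fderiv_fderiv_comm (H.contDiffAt hx) v w]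

theorem fderiv_metric_comm (u v w : Euc n) :
    fderiv ℝ (metric ε F) x u v w = fderiv ℝ (metric ε F) x u w v :=
  have h := H.hasFDerivAt_metric hx
  hasFDerivAt_unique_of_eqOn (hasFDerivAt_clm_apply_const (hasFDerivAt_clm_apply_const h v) w)
    (hasFDerivAt_clm_apply_const (hasFDerivAt_clm_apply_const h w) v) H.isOpen hx
    (fun _ hy => H.metric_comm hy v w) u

theorem metric_christoffel (u v w : Euc n) :
    metric ε F x (christoffel (metric ε F) x u v) w = (1 / 2) *
      (fderiv ℝ (metric ε F) x u v w + fderiv ℝ (metric ε F) x v u w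
        - fderiv ℝ (metric ε F) x w u v) := by
  rw [christoffel_apply, leviCivita, (H.isInvertible_metric hx).self_apply_inverse]
  simp

theorem christoffel_comm (u v : Euc n) :
    christoffel (metric ε F) x u v = christoffel (metric ε F) x v u := by
  refine H.eq_of_metric_eq hx fun z => ?_
  rw [H.metric_christoffel hx, H.metric_christoffel hx, H.fderiv_metric_comm hx z u v]
  ring

theorem fderiv_metric (u v w : Euc n) :
    fderiv ℝ (metric ε F) x u v w =
      metric ε F x (christoffel (metric ε F) x u v) w
        + metric ε F x v (christoffel (metric ε F) x u w) := by
  rw [H.metric_comm hx v, H.metric_christoffel hx, H.metric_christoffel hx,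
    H.fderiv_metric_comm hx v u w, H.fderiv_metric_comm hx w u v, H.fderiv_metric_comm hx u w v]
  ring

theorem difference_comm (u v : Euc n) : difference ε F x u v = difference ε F x v u := by
  simp [difference, H.christoffel_comm hx u v, H.inducedConnection_comm hx u v]

theorem hasFDerivAt_frame_field {ξ : Euc n → Euc n} {ξ' : Euc n →L[ℝ] Euc n} {c : Euc n → ℝ}
    {c' : Euc n →L[ℝ] ℝ} (hξ : HasFDerivAt ξ ξ' x) (hc : HasFDerivAt c c' x) :
    HasFDerivAt (fun y => gaussFrame ε F y (ξ y, c y)) ((gaussFrame ε F x).comp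
      ((ξ' + (inducedConnection ε F x).flip (ξ x) -
        (c x * ε) • ContinuousLinearMap.id ℝ (Euc n)).prod (c' + (metric ε F x).flip (ξ x)))) x :=
  hasFDerivAt_gaussFrame_field (H.contDiffAt hx) (gauss_formula (H.frame x hx)) hξ hc

theorem fderiv_fderiv_fderiv (u v w : Euc n) :
    fderiv ℝ (fderiv ℝ (fderiv ℝ F)) x u v w = gaussFrame ε F x
      (fderiv ℝ (inducedConnection ε F) x u v w
        + inducedConnection ε F x u (inducedConnection ε F x v w) - (metric ε F x v w * ε) • u,
      fderiv ℝ (metric ε F) x u v w + metric ε F x u (inducedConnection ε F x v w)) := by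
  have hD := hasFDerivAt_of_contDiffAt_infty (contDiffAt_infty_fderiv (H.contDiffAt_fderiv hx))
  have hΓ := hasFDerivAt_of_contDiffAt_infty (H.contDiffAt_inducedConnection hx)
  have happly {G : Type} [NormedAddCommGroup G] [NormedSpace ℝ G]
      {f : Euc n → Euc n →L[ℝ] Euc n →L[ℝ] G} {f'} (hf : HasFDerivAt f f' x) :=
    hasFDerivAt_clm_apply_const (hasFDerivAt_clm_apply_const hf v) w
  exact hasFDerivAt_unique_of_eqOn (happly hD)
    (H.hasFDerivAt_frame_field hx (happly hΓ) (happly (H.hasFDerivAt_metric hx))) H.isOpen hx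
    (fun y hy => gauss_formula (H.frame y hy) v w) u

/-- The Codazzi equation: `h(K(v, w), u)` is totally symmetric, because `D³F` is symmetric. -/
theorem metric_difference_comm (u v w : Euc n) :
    metric ε F x u (difference ε F x v w) = metric ε F x v (difference ε F x u w) := by
  have h := DFunLike.congr_fun (fderiv_fderiv_comm (H.contDiffAt_fderiv hx) u v) w
  rw [H.fderiv_fderiv_fderiv hx, H.fderiv_fderiv_fderiv hx] at h
  have hnormal := congrArg Prod.snd ((H.frame x hx).injective h)
  simp only [H.fderiv_metric hx, inducedConnection_eq, add_apply, map_add,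
    H.christoffel_comm hx v u] at hnormal
  linarith

theorem fderiv_difference {u v w : Euc n} (hK : covDerivDifferenceTensor ε F x u v w = 0) :
    fderiv ℝ (difference ε F) x u v w =
      difference ε F x (christoffel (metric ε F) x u v) w
      + difference ε F x v (christoffel (metric ε F) x u w)
      - christoffel (metric ε F) x u (difference ε F x v w) := by
  have h := hasFDerivAt_clm_apply_const
    (hasFDerivAt_clm_apply_const (H.hasFDerivAt_difference hx) v) w
  simp only [covDerivDifferenceTensor, ← difference_apply, ← christoffel_metric_apply, h.fderiv,
    ContinuousLinearMap.flip_apply] at hK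
  linear_combination (norm := module) hK

end ConvexParam
end ConvexParametrization

/-! ### The parallel field `τ` and the endomorphism `B` -/

section Rigidity

variable {n : ℕ} {ε : ℝ} {F φ : Euc n → Euc (n + 1)} {Ω : Set (Euc n)} (H : ConvexParam ε F Ω)
include H

theorem ConvexParam.hasFDerivAt_gaussFrame_comp_inverse {x : Euc n} (hx : x ∈ Ω)
    (hφ : ContDiffAt ℝ ∞ φ x)
    (hG : ∀ u v, fderiv ℝ (fderiv ℝ φ) x u v =
      gaussFrame ε φ x (inducedConnection ε F x u v, metric ε F x u v)) :
    HasFDerivAt (𝕜 := ℝ) (fun y => (gaussFrame ε φ y).comp (gaussFrame ε F y).inverse) 0 x := by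
  set B := fun y => (gaussFrame ε φ y).comp (gaussFrame ε F y).inverse
  have hB_frame : ∀ y ∈ Ω, ∀ p, gaussFrame ε φ y p = B y (gaussFrame ε F y p) := fun y hy p => by
    simp [B, (H.frame y hy).inverse_apply_self]
  have hB : HasFDerivAt B (fderiv ℝ B x) x := hasFDerivAt_of_contDiffAt_infty
    ((contDiffAt_gaussFrame ε hφ).clm_comp (H.contDiffAt_frame_inverse hx))
  suffices h : ∀ u p, fderiv ℝ B x u (gaussFrame ε F x p) = 0 by
    refine hB.congr_fderiv (ContinuousLinearMap.ext fun u => ContinuousLinearMap.ext fun z => ?_)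
    obtain ⟨p, rfl⟩ := (H.frame x hx).surjective z
    exact h u p
  rintro u ⟨v, c⟩
  have hv := hasFDerivAt_const (𝕜 := ℝ) v x
  have hc := hasFDerivAt_const (𝕜 := ℝ) c x
  have h := hasFDerivAt_unique_of_eqOn (hasFDerivAt_gaussFrame_field hφ hG hv hc)
    (hB.clm_apply (H.hasFDerivAt_frame_field hx hv hc)) H.isOpen hx
    (fun y hy => hB_frame y hy (v, c)) u
  simpa [hB_frame x hx] using h

/-- The Gauss formula is a linear differential equation, so that a solution with the connection and
the metric of `F` is a linear image of `F`. -/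
theorem ConvexParam.exists_eq_clm (hΩ : Convex ℝ Ω) (hφ : ContDiffOn ℝ ∞ φ Ω)
    (hG : ∀ x ∈ Ω, ∀ u v, fderiv ℝ (fderiv ℝ φ) x u v =
      gaussFrame ε φ x (inducedConnection ε F x u v, metric ε F x u v)) :
    ∃ B : Euc (n + 1) →L[ℝ] Euc (n + 1), Set.EqOn φ (B ∘ F) Ω := by
  rcases Ω.eq_empty_or_nonempty with rfl | ⟨x₀, hx₀⟩
  · exact ⟨0, Set.eqOn_empty _ _⟩
  set B := fun y => (gaussFrame ε φ y).comp (gaussFrame ε F y).inverse with hB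
  have hB_deriv : ∀ x ∈ Ω, HasFDerivAt (𝕜 := ℝ) B 0 x := fun x hx =>
    H.hasFDerivAt_gaussFrame_comp_inverse hx (hφ.contDiffAt (H.isOpen.mem_nhds hx)) (hG x hx)
  have hB_const : ∀ x ∈ Ω, B x = B x₀ := fun x hx =>
    hΩ.is_const_of_fderivWithin_eq_zero (𝕜 := ℝ)
      (fun z hz => (hB_deriv z hz).differentiableAt.differentiableWithinAt)
      (fun z hz => by rw [fderivWithin_of_isOpen H.isOpen hz, (hB_deriv z hz).fderiv]) hx hx₀
  refine ⟨B x₀, fun x hx => ?_⟩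
  have hposition : gaussFrame ε φ x (0, 1) = B x (gaussFrame ε F x (0, 1)) := by
    simp [hB, (H.frame x hx).inverse_apply_self]
  simp only [gaussFrame_apply, map_zero, zero_add, one_smul, map_neg, map_smul, neg_inj]
    at hposition
  rw [Function.comp_apply, ← hB_const x hx]
  exact smul_right_injective _ (H.sign_ne_zero hx) hposition

end Rigidity

noncomputable section Splitting

variable {n : ℕ}

/-- The hypotheses of the theorem in a coordinate domain `Ω`: the difference tensor `K` of the
hypersurface `F` is parallel, and `K(τ, ·)` has the eigenvalues `l₁`, `l₂`, `l₃` on the unit field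
`τ` and on the orthogonal distributions `D₂` and `D₃` of dimensions `n₁` and `n₂`. -/
structure EigenSplitting (ε : ℝ) (F : Euc n → Euc (n + 1)) (Ω : Set (Euc n))
    (τ : Euc n → Euc n) (D₂ D₃ : Euc n → Submodule ℝ (Euc n)) (n₁ n₂ : ℕ) (l₁ l₂ l₃ : ℝ) :
    Prop extends ConvexParam ε F Ω where
  parallel : ∀ x ∈ Ω, ∀ u v w, covDerivDifferenceTensor ε F x u v w = 0
  smooth_field : ContDiffOn ℝ ∞ τ Ω
  dim : 1 + n₁ + n₂ = n
  pos₁ : 1 ≤ n₁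
  pos₂ : 1 ≤ n₂
  finrank₂ : ∀ x ∈ Ω, Module.finrank ℝ (D₂ x) = n₁
  finrank₃ : ∀ x ∈ Ω, Module.finrank ℝ (D₃ x) = n₂
  unit : ∀ x ∈ Ω, metric ε F x (τ x) (τ x) = 1
  orth₂ : ∀ x ∈ Ω, ∀ v ∈ D₂ x, metric ε F x (τ x) v = 0
  orth₃ : ∀ x ∈ Ω, ∀ w ∈ D₃ x, metric ε F x (τ x) w = 0
  orth₂₃ : ∀ x ∈ Ω, ∀ v ∈ D₂ x, ∀ w ∈ D₃ x, metric ε F x v w = 0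
  eigen₁ : ∀ x ∈ Ω, difference ε F x (τ x) (τ x) = l₁ • τ x
  eigen₂ : ∀ x ∈ Ω, ∀ v ∈ D₂ x, difference ε F x (τ x) v = l₂ • v
  eigen₃ : ∀ x ∈ Ω, ∀ w ∈ D₃ x, difference ε F x (τ x) w = l₃ • w
  ne₁₂ : l₁ ≠ 2 * l₂
  ne₁₃ : l₁ ≠ 2 * l₃
  ne₂₃ : l₂ ≠ l₃

/-- The vector field `dF(τ)` along `F`. -/
def imageField (F : Euc n → Euc (n + 1)) (τ : Euc n → Euc n) (x : Euc n) : Euc (n + 1) :=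
  fderiv ℝ F x (τ x)

namespace EigenSplitting

variable {ε : ℝ} {F : Euc n → Euc (n + 1)} {Ω : Set (Euc n)} {τ : Euc n → Euc n}
  {D₂ D₃ : Euc n → Submodule ℝ (Euc n)} {n₁ n₂ : ℕ} {l₁ l₂ l₃ : ℝ}
  (S : EigenSplitting ε F Ω τ D₂ D₃ n₁ n₂ l₁ l₂ l₃) {x : Euc n} (hx : x ∈ Ω)
include S

theorem swap : EigenSplitting ε F Ω τ D₃ D₂ n₂ n₁ l₁ l₃ l₂ :=
  { S with
    dim := by rw [add_right_comm, S.dim]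
    pos₁ := S.pos₂
    pos₂ := S.pos₁
    finrank₂ := S.finrank₃
    finrank₃ := S.finrank₂
    orth₂ := S.orth₃
    orth₃ := S.orth₂
    orth₂₃ := fun x hx v hv w hw => by
      rw [S.metric_comm hx]; exact S.orth₂₃ x hx w hw v hv
    eigen₂ := S.eigen₃
    eigen₃ := S.eigen₂
    ne₁₂ := S.ne₁₃
    ne₁₃ := S.ne₁₂
    ne₂₃ := S.ne₂₃.symm }

theorem mono {Ω' : Set (Euc n)} (hΩ' : IsOpen Ω') (h : Ω' ⊆ Ω) :
    EigenSplitting ε F Ω' τ D₂ D₃ n₁ n₂ l₁ l₂ l₃ :=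
  { S with
    toConvexParam := S.toConvexParam.mono hΩ' h
    parallel := fun x hx => S.parallel x (h hx)
    smooth_field := S.smooth_field.mono h
    finrank₂ := fun x hx => S.finrank₂ x (h hx)
    finrank₃ := fun x hx => S.finrank₃ x (h hx)
    unit := fun x hx => S.unit x (h hx)
    orth₂ := fun x hx => S.orth₂ x (h hx)
    orth₃ := fun x hx => S.orth₃ x (h hx)
    orth₂₃ := fun x hx => S.orth₂₃ x (h hx)
    eigen₁ := fun x hx => S.eigen₁ x (h hx)
    eigen₂ := fun x hx => S.eigen₂ x (h hx)
    eigen₃ := fun x hx => S.eigen₃ x (h hx) }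

include hx

theorem components_eq_zero {v w : Euc n} {c : ℝ} (hv : v ∈ D₂ x) (hw : w ∈ D₃ x)
    (h : c • τ x + v + w = 0) : c = 0 ∧ v = 0 ∧ w = 0 := by
  have hτ_comp := congrArg (metric ε F x (τ x)) h
  have hv_comp := congrArg (metric ε F x v) h
  have hw_comp := congrArg (metric ε F x w) h
  simp only [map_add, map_smul, S.unit x hx, S.orth₂ x hx v hv, S.orth₃ x hx w hw,
    S.orth₂₃ x hx v hv w hw, S.metric_comm hx v (τ x), S.metric_comm hx w (τ x),
    S.metric_comm hx w v, smul_eq_mul, map_zero, mul_zero, mul_one, add_zero, zero_add]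
    at hτ_comp hv_comp hw_comp
  exact ⟨hτ_comp, S.eq_zero_of_metric_self hx hv_comp, S.eq_zero_of_metric_self hx hw_comp⟩

theorem exists_decomposition (X : Euc n) :
    ∃ v ∈ D₂ x, ∃ w ∈ D₃ x, X = metric ε F x (τ x) X • τ x + v + w := by
  let f : (ℝ × D₂ x × D₃ x) →ₗ[ℝ] Euc n :=
    (LinearMap.toSpanSingleton ℝ (Euc n) (τ x)).coprod ((D₂ x).subtype.coprod (D₃ x).subtype)
  have hf : ∀ c v w, f (c, v, w) = c • τ x + v + w := fun c v w => by simp [f, add_assoc]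
  have hinj : Function.Injective f := by
    refine (injective_iff_map_eq_zero f).2 ?_
    rintro ⟨c, v, w⟩ h
    rw [hf] at h
    obtain ⟨rfl, hv, hw⟩ := S.components_eq_zero hx v.2 w.2 h
    simp [Subtype.ext_iff, hv, hw]
  have hsurj : Function.Surjective f := by
    refine (LinearMap.injective_iff_surjective_of_finrank_eq_finrank ?_).1 hinj
    simp only [Module.finrank_prod, Module.finrank_self, S.finrank₂ x hx, S.finrank₃ x hx,
      finrank_euclideanSpace_fin]
    rw [← S.dim, add_assoc]
  obtain ⟨⟨c, v, w⟩, rfl⟩ := hsurj X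
  refine ⟨v, v.2, w, w.2, ?_⟩
  simp [hf, S.unit x hx, S.orth₂ x hx v v.2, S.orth₃ x hx w w.2]

theorem contDiffAt_field : ContDiffAt ℝ ∞ τ x :=
  S.smooth_field.contDiffAt (S.isOpen.mem_nhds hx)

theorem metric_covDeriv_field (u : Euc n) :
    metric ε F x (τ x) (fderiv ℝ τ x u + christoffel (metric ε F) x u (τ x)) = 0 := by
  have hτ := hasFDerivAt_of_contDiffAt_infty (S.contDiffAt_field hx)
  have h := hasFDerivAt_unique_of_eqOn (((S.hasFDerivAt_metric hx).clm_apply hτ).clm_apply hτ)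
    (hasFDerivAt_const 1 x) S.isOpen hx (fun y hy => S.unit y hy) u
  simp only [add_apply, zero_apply, ContinuousLinearMap.comp_apply,
    ContinuousLinearMap.flip_apply, S.fderiv_metric hx, S.metric_comm hx _ (τ x)] at h
  rw [map_add]
  linarith

theorem difference_covDeriv_field (u : Euc n) :
    (2 : ℝ) • difference ε F x (τ x) (fderiv ℝ τ x u + christoffel (metric ε F) x u (τ x)) =
      l₁ • (fderiv ℝ τ x u + christoffel (metric ε F) x u (τ x)) := by
  have hτ := hasFDerivAt_of_contDiffAt_infty (S.contDiffAt_field hx)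
  have h := hasFDerivAt_unique_of_eqOn (((S.hasFDerivAt_difference hx).clm_apply hτ).clm_apply hτ)
    (hτ.const_smul l₁) S.isOpen hx (fun y hy => S.eigen₁ y hy) u
  simp only [add_apply, smul_apply, ContinuousLinearMap.comp_apply,
    ContinuousLinearMap.flip_apply, S.fderiv_difference hx (S.parallel x hx _ _ _),
    S.difference_comm hx _ (τ x), S.eigen₁ x hx, map_smul] at h
  rw [map_add]
  linear_combination (norm := module) h

/-- `∇̂τ = 0`: since `∇̂_u τ` is orthogonal to `τ` and satisfies `2 K(τ, ∇̂_u τ) = l₁ ∇̂_u τ`, its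
components in `D₂` and `D₃` vanish by `l₁ ≠ 2 l₂` and `l₁ ≠ 2 l₃`. -/
theorem fderiv_field (u : Euc n) :
    fderiv ℝ τ x u = -christoffel (metric ε F) x u (τ x) := by
  have horth := S.metric_covDeriv_field hx u
  have heigen := S.difference_covDeriv_field hx u
  rw [eq_neg_iff_add_eq_zero]
  set Z := fderiv ℝ τ x u + christoffel (metric ε F) x u (τ x)
  obtain ⟨v, hv, w, hw, hZ⟩ := S.exists_decomposition hx Z
  rw [horth, zero_smul, zero_add] at hZ
  have h : (0 : ℝ) • τ x + (l₁ - 2 * l₂) • v + (l₁ - 2 * l₃) • w = 0 := by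
    rw [hZ, map_add, S.eigen₂ x hx v hv, S.eigen₃ x hx w hw] at heigen
    linear_combination (norm := module) -heigen
  obtain ⟨-, hv0, hw0⟩ := S.components_eq_zero hx ((D₂ x).smul_mem _ hv) ((D₃ x).smul_mem _ hw) h
  rw [hZ, (smul_eq_zero.1 hv0).resolve_left (sub_ne_zero.2 S.ne₁₂),
    (smul_eq_zero.1 hw0).resolve_left (sub_ne_zero.2 S.ne₁₃), add_zero]

theorem hasFDerivAt_field : HasFDerivAt τ (-(christoffel (metric ε F) x).flip (τ x)) x :=
  (hasFDerivAt_of_contDiffAt_infty (S.contDiffAt_field hx)).congr_fderiv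
    (ContinuousLinearMap.ext (S.fderiv_field hx))

theorem hasFDerivAt_metric_field :
    HasFDerivAt (fun y => metric ε F y (τ y))
      ((ContinuousLinearMap.compL ℝ (Euc n) (Euc n) ℝ (metric ε F x (τ x))).comp
        (christoffel (metric ε F) x)) x := by
  refine ((S.hasFDerivAt_metric hx).clm_apply (S.hasFDerivAt_field hx)).congr_fderiv ?_
  ext u v
  simp [S.fderiv_metric hx]

theorem hasFDerivAt_difference_field :
    HasFDerivAt (fun y => difference ε F y (τ y))
      ((ContinuousLinearMap.compL ℝ (Euc n) (Euc n) (Euc n) (difference ε F x (τ x))).comp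
        (christoffel (metric ε F) x) -
        ((ContinuousLinearMap.compL ℝ (Euc n) (Euc n) (Euc n)).flip
          (difference ε F x (τ x))).comp (christoffel (metric ε F) x)) x := by
  refine ((S.hasFDerivAt_difference hx).clm_apply (S.hasFDerivAt_field hx)).congr_fderiv ?_
  refine ContinuousLinearMap.ext fun u => ContinuousLinearMap.ext fun v => ?_
  simp only [add_apply, sub_apply, neg_apply, ContinuousLinearMap.comp_apply,
    ContinuousLinearMap.flip_apply, ContinuousLinearMap.compL_apply, map_neg,
    S.fderiv_difference hx (S.parallel x hx _ _ _)]
  abel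

theorem hasFDerivAt_imageField :
    HasFDerivAt (imageField F τ)
      ((gaussFrame ε F x).comp ((difference ε F x (τ x)).prod (metric ε F x (τ x)))) x := by
  have h := S.hasFDerivAt_frame_field hx (S.hasFDerivAt_field hx) (hasFDerivAt_const 0 x)
  simp only [gaussFrame_apply_zero] at h
  refine h.congr_fderiv (ContinuousLinearMap.ext fun u => congrArg (gaussFrame ε F x) ?_)
  simp [inducedConnection_eq, S.difference_comm hx u, S.metric_comm hx u]

theorem contDiffAt_imageField : ContDiffAt ℝ ∞ (imageField F τ) x :=
  (S.contDiffAt_fderiv hx).clm_apply (S.contDiffAt_field hx)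

theorem fderiv_fderiv_imageField (u v : Euc n) :
    fderiv ℝ (fderiv ℝ (imageField F τ)) x u v = gaussFrame ε F x
      (difference ε F x u (difference ε F x (τ x) v)
        + difference ε F x (τ x) (christoffel (metric ε F) x u v)
        - (metric ε F x (τ x) v * ε) • u,
      metric ε F x u (difference ε F x (τ x) v)
        + metric ε F x (τ x) (christoffel (metric ε F) x u v)) := by
  have h := hasFDerivAt_unique_of_eqOn
    (hasFDerivAt_clm_apply_const (hasFDerivAt_of_contDiffAt_infty
      (contDiffAt_infty_fderiv (S.contDiffAt_imageField hx))) v)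
    (S.hasFDerivAt_frame_field hx
      (hasFDerivAt_clm_apply_const (S.hasFDerivAt_difference_field hx) v)
      (hasFDerivAt_clm_apply_const (S.hasFDerivAt_metric_field hx) v)) S.isOpen hx
    (fun y hy => DFunLike.congr_fun (S.hasFDerivAt_imageField hy).fderiv v) u
  simp only [inducedConnection_eq, add_apply, sub_apply, smul_apply, ContinuousLinearMap.flip_apply,
    ContinuousLinearMap.comp_apply, ContinuousLinearMap.compL_apply,
    ContinuousLinearMap.prod_apply, ContinuousLinearMap.id_apply] at h
  exact h.trans (congrArg (gaussFrame ε F x) (Prod.ext (by module) (by ring)))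

/-- The equation `R̂(u, v) τ = 0`, in the form in which the Gauss equation expresses the curvature
`R̂` of `h` by `K`. -/
theorem curvature_identity (u v : Euc n) :
    difference ε F x u (difference ε F x (τ x) v) - (metric ε F x (τ x) v * ε) • u =
      difference ε F x v (difference ε F x (τ x) u) - (metric ε F x (τ x) u * ε) • v := by
  have h := fderiv_fderiv_comm (S.contDiffAt_imageField hx) u v
  rw [S.fderiv_fderiv_imageField hx, S.fderiv_fderiv_imageField hx] at h
  have htangent := congrArg Prod.fst ((S.frame x hx).injective h)
  dsimp only at htangent
  rw [S.christoffel_comm hx v u] at htangent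
  linear_combination (norm := module) htangent

theorem exists_ne_zero : ∃ v ∈ D₂ x, v ≠ 0 :=
  Submodule.exists_mem_ne_zero_of_ne_bot fun h =>
    Nat.not_succ_le_zero 0 (by simpa [h] using S.pos₁.trans_eq (S.finrank₂ x hx).symm)

theorem eigenvalue_sq : l₂ ^ 2 = l₁ * l₂ - ε := by
  obtain ⟨v, hv, hv0⟩ := S.exists_ne_zero hx
  have h := S.curvature_identity hx v (τ x)
  rw [S.eigen₁ x hx, S.unit x hx, S.eigen₂ x hx v hv, S.orth₂ x hx v hv] at h
  simp only [map_smul, S.difference_comm hx v (τ x), S.eigen₂ x hx v hv] at h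
  have hsmul : (l₂ ^ 2 - (l₁ * l₂ - ε)) • v = 0 := by
    linear_combination (norm := module) -h
  exact sub_eq_zero.1 ((smul_eq_zero.1 hsmul).resolve_right hv0)

theorem eigenvalue_sum : l₁ = l₂ + l₃ := by
  have h : (l₂ - l₃) * (l₁ - (l₂ + l₃)) = 0 := by
    linear_combination S.swap.eigenvalue_sq hx - S.eigenvalue_sq hx
  exact sub_eq_zero.1 ((mul_eq_zero.1 h).resolve_left (sub_ne_zero.2 S.ne₂₃))

theorem eigenvalue_prod : l₂ * l₃ = ε := by
  linear_combination -l₂ * S.eigenvalue_sum hx - S.eigenvalue_sq hx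

theorem difference_mixed {v w : Euc n} (hv : v ∈ D₂ x) (hw : w ∈ D₃ x) :
    difference ε F x v w = 0 := by
  have h := S.curvature_identity hx v w
  rw [S.eigen₂ x hx v hv, S.eigen₃ x hx w hw, S.orth₂ x hx v hv, S.orth₃ x hx w hw] at h
  simp only [map_smul, S.difference_comm hx w v] at h
  have hsmul : (l₃ - l₂) • difference ε F x v w = 0 := by
    linear_combination (norm := module) h
  exact (smul_eq_zero.1 hsmul).resolve_left (sub_ne_zero.2 S.ne₂₃.symm)

theorem exists_difference_eq (u : Euc n) {v : Euc n} (hv : v ∈ D₂ x) :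
    ∃ z ∈ D₂ x, difference ε F x u v = (l₂ * metric ε F x u v) • τ x + z := by
  obtain ⟨z, hz, w, hw, h⟩ := S.exists_decomposition hx (difference ε F x u v)
  have hτ : metric ε F x (τ x) (difference ε F x u v) = l₂ * metric ε F x u v := by
    rw [S.metric_difference_comm hx, S.eigen₂ x hx v hv, map_smul, smul_eq_mul]
  have hw_orth : metric ε F x w (difference ε F x u v) = 0 := by
    rw [S.metric_difference_comm hx, S.difference_comm hx, S.difference_mixed hx hv hw, map_zero]
  have hw0 : w = 0 := by
    refine S.eq_zero_of_metric_self hx ?_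
    rw [h, map_add, map_add, map_smul, S.metric_comm hx w (τ x), S.orth₃ x hx w hw,
      S.metric_comm hx w z, S.orth₂₃ x hx z hz w hw] at hw_orth
    simpa using hw_orth
  exact ⟨z, hz, by rwa [hτ, hw0, add_zero] at h⟩

/-- Together with the Codazzi equation this says that `dF(τ)` satisfies the Gauss formula of `F`. -/
theorem difference_commutation (u v : Euc n) :
    difference ε F x u (difference ε F x (τ x) v) - (metric ε F x (τ x) v * ε) • u =
      difference ε F x (τ x) (difference ε F x u v) - (metric ε F x u v * ε) • τ x := by
  obtain rfl := S.eigenvalue_sum hx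
  obtain rfl := S.eigenvalue_prod hx
  obtain ⟨v₂, hv₂, v₃, hv₃, hv⟩ := S.exists_decomposition hx v
  obtain ⟨u₂, hu₂, u₃, hu₃, hu⟩ := S.exists_decomposition hx u
  generalize metric (l₂ * l₃) F x (τ x) v = b at hv
  generalize metric (l₂ * l₃) F x (τ x) u = a at hu
  obtain ⟨z₂, hz₂, hK₂⟩ := S.exists_difference_eq hx u₂ hv₂
  obtain ⟨z₃, hz₃, hK₃⟩ := S.swap.exists_difference_eq hx u₃ hv₃
  rw [hv, hu]
  simp only [map_add, map_smul, map_zero, add_apply, smul_apply,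
    S.eigen₁ x hx, S.eigen₂ x hx _ hv₂, S.eigen₃ x hx _ hv₃, S.eigen₂ x hx _ hu₂,
    S.eigen₃ x hx _ hu₃, S.difference_comm hx _ (τ x), S.difference_mixed hx hu₂ hv₃,
    S.swap.difference_mixed hx hu₃ hv₂, hK₂, hK₃, S.eigen₂ x hx _ hz₂, S.eigen₃ x hx _ hz₃,
    S.metric_comm hx u₂ (τ x), S.metric_comm hx u₃ (τ x), S.orth₂ x hx _ hv₂, S.orth₃ x hx _ hv₃,
    S.orth₂ x hx _ hu₂, S.orth₃ x hx _ hu₃, S.orth₂₃ x hx _ hu₂ _ hv₃, S.unit x hx,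
    S.metric_comm hx u₃ v₂, S.orth₂₃ x hx _ hv₂ _ hu₃, smul_eq_mul]
  module

omit hx in
theorem exists_endomorphism (hΩ : Convex ℝ Ω) :
    ∃ B : Euc (n + 1) →L[ℝ] Euc (n + 1), Set.EqOn (imageField F τ) (B ∘ F) Ω := by
  refine S.exists_eq_clm hΩ (fun x hx => (S.contDiffAt_imageField hx).contDiffWithinAt)
    fun x hx u v => ?_
  have hfirst := fun z => DFunLike.congr_fun (S.hasFDerivAt_imageField hx).fderiv z
  have hvalue : imageField F τ x = gaussFrame ε F x (τ x, 0) := (gaussFrame_apply_zero ..).symm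
  rw [S.fderiv_fderiv_imageField hx, gaussFrame_apply ε (imageField F τ), hfirst, hvalue]
  simp only [ContinuousLinearMap.comp_apply, ContinuousLinearMap.prod_apply, ← map_smul, ← map_neg,
    ← map_add, inducedConnection_eq, add_apply, Prod.smul_mk, Prod.neg_mk, Prod.mk_add_mk]
  refine congrArg (gaussFrame ε F x) (Prod.ext ?_ ?_)
  · simp only [map_add]
    linear_combination (norm := module) S.difference_commutation hx u v
  · simp [S.metric_difference_comm hx u (τ x) v, add_comm]

end EigenSplitting
end Splitting

section Eigenspaces

theorem exists_equiv_prod_of_eigenspaces {K V W₁ W₂ : Type*} [Field K]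
    [AddCommGroup V] [Module K V] [AddCommGroup W₁] [Module K W₁] [AddCommGroup W₂] [Module K W₂]
    [FiniteDimensional K V] [FiniteDimensional K W₁] [FiniteDimensional K W₂]
    (B : Module.End K V) {l₁ l₂ : K} (hl : l₁ ≠ l₂)
    (hV : Module.finrank K V = Module.finrank K W₁ + Module.finrank K W₂)
    (h₁ : Module.finrank K W₁ ≤ Module.finrank K (B.eigenspace l₁))
    (h₂ : Module.finrank K W₂ ≤ Module.finrank K (B.eigenspace l₂)) :
    ∃ A : V ≃ₗ[K] W₁ × W₂, ∀ z, A (B z) = (l₁ • (A z).1, l₂ • (A z).2) := by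
  have hdisj : Disjoint (B.eigenspace l₁) (B.eigenspace l₂) :=
    B.eigenspaces_iSupIndep.pairwiseDisjoint hl
  have hsum := Submodule.finrank_sup_add_finrank_inf_eq (B.eigenspace l₁) (B.eigenspace l₂)
  rw [hdisj.eq_bot, finrank_bot, add_zero] at hsum
  have hle := Submodule.finrank_le (B.eigenspace l₁ ⊔ B.eigenspace l₂)
  have hcompl : IsCompl (B.eigenspace l₁) (B.eigenspace l₂) :=
    ⟨hdisj, codisjoint_iff.2 (Submodule.eq_top_of_finrank_eq (by lia))⟩
  let e₁ : B.eigenspace l₁ ≃ₗ[K] W₁ := LinearEquiv.ofFinrankEq _ _ (by lia)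
  let e₂ : B.eigenspace l₂ ≃ₗ[K] W₂ := LinearEquiv.ofFinrankEq _ _ (by lia)
  let e := Submodule.prodEquivOfIsCompl _ _ hcompl
  refine ⟨e.symm.trans (e₁.prodCongr e₂), fun z => ?_⟩
  obtain ⟨⟨a, b⟩, rfl⟩ := e.surjective z
  have hB : B (e (a, b)) = e (l₁ • a, l₂ • b) := by
    simp [e, Module.End.mem_eigenspace_iff.1 a.2, Module.End.mem_eigenspace_iff.1 b.2]
  simp [hB]

/-- `A` intertwines `B` with the scalar `l` and is injective on the `l`-eigenspace of `B`; as for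
the projection onto this eigenspace along a complement that is invariant under `B`. -/
structure IsEigenProjection {𝕜 V W : Type*} [NormedField 𝕜] [NormedAddCommGroup V]
    [NormedSpace 𝕜 V] [NormedAddCommGroup W] [NormedSpace 𝕜 W] (B : V →L[𝕜] V) (l : 𝕜)
    (A : V →L[𝕜] W) : Prop where
  map : ∀ z, A (B z) = l • A z
  injective : ∀ z, B z = l • z → A z = 0 → z = 0

theorem IsEigenProjection.smul {𝕜 V W : Type*} [NormedField 𝕜] [NormedAddCommGroup V]
    [NormedSpace 𝕜 V] [NormedAddCommGroup W] [NormedSpace 𝕜 W] {B : V →L[𝕜] V} {l : 𝕜}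
    {A : V →L[𝕜] W} (h : IsEigenProjection B l A) {c : 𝕜} (hc : c ≠ 0) :
    IsEigenProjection B l (c • A) where
  map z := by simp [h.map, smul_comm c l]
  injective z hz hA := h.injective z hz ((smul_eq_zero.1 hA).resolve_left hc)

end Eigenspaces

noncomputable section EigenProjections

variable {n : ℕ}

/-- The orthogonal projection `(l₂ - l₃)⁻¹ (K(τ, ·) - l₃ - l₂ h(τ, ·) τ)` onto the distribution
`D₂`. -/
def eigenProj (ε : ℝ) (F : Euc n → Euc (n + 1)) (τ : Euc n → Euc n) (l₂ l₃ : ℝ) (x : Euc n) :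
    Euc n →L[ℝ] Euc n :=
  (l₂ - l₃)⁻¹ • (difference ε F x (τ x) - l₃ • ContinuousLinearMap.id ℝ (Euc n)
    - l₂ • (metric ε F x (τ x)).smulRight (τ x))

theorem eigenProj_apply (ε : ℝ) (F : Euc n → Euc (n + 1)) (τ : Euc n → Euc n) (l₂ l₃ : ℝ)
    (x v : Euc n) :
    eigenProj ε F τ l₂ l₃ x v = (l₂ - l₃)⁻¹ • (difference ε F x (τ x) v - l₃ • v
      - (l₂ * metric ε F x (τ x) v) • τ x) := by
  simp [eigenProj, mul_smul]

namespace EigenSplitting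

variable {ε : ℝ} {F : Euc n → Euc (n + 1)} {Ω : Set (Euc n)} {τ : Euc n → Euc n}
  {D₂ D₃ : Euc n → Submodule ℝ (Euc n)} {n₁ n₂ : ℕ} {l₁ l₂ l₃ : ℝ}
  (S : EigenSplitting ε F Ω τ D₂ D₃ n₁ n₂ l₁ l₂ l₃) {x : Euc n} (hx : x ∈ Ω)
include S hx

theorem eigenProj_add {v w : Euc n} (c : ℝ) (hv : v ∈ D₂ x) (hw : w ∈ D₃ x) :
    eigenProj ε F τ l₂ l₃ x (c • τ x + v + w) = v := by
  rw [eigenProj_apply, inv_smul_eq_iff₀ (sub_ne_zero.2 S.ne₂₃)]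
  simp only [map_add, map_smul, S.eigen₁ x hx, S.eigen₂ x hx v hv, S.eigen₃ x hx w hw,
    S.unit x hx, S.orth₂ x hx v hv, S.orth₃ x hx w hw, S.eigenvalue_sum hx, smul_eq_mul]
  module

theorem eigenProj_of_mem {v : Euc n} (hv : v ∈ D₂ x) : eigenProj ε F τ l₂ l₃ x v = v := by
  simpa using S.eigenProj_add hx 0 hv (zero_mem (D₃ x))

theorem eigenProj_eq_zero_of_mem {w : Euc n} (hw : w ∈ D₃ x) : eigenProj ε F τ l₂ l₃ x w = 0 := by
  simpa using S.eigenProj_add hx 0 (zero_mem (D₂ x)) hw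

theorem eigenProj_mem (v : Euc n) : eigenProj ε F τ l₂ l₃ x v ∈ D₂ x := by
  obtain ⟨a, ha, b, hb, h⟩ := S.exists_decomposition hx v
  rw [h, S.eigenProj_add hx _ ha hb]
  exact ha

theorem metric_eigenProj (v : Euc n) {w : Euc n} (hw : w ∈ D₂ x) :
    metric ε F x (eigenProj ε F τ l₂ l₃ x v) w = metric ε F x v w := by
  obtain ⟨a, ha, b, hb, h⟩ := S.exists_decomposition hx v
  generalize metric ε F x (τ x) v = c at h
  rw [h, S.eigenProj_add hx _ ha hb]
  simp [S.orth₂ x hx w hw, S.metric_comm hx b, S.orth₂₃ x hx w hw b hb]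

theorem eq_add_eigenProj (v : Euc n) :
    v = metric ε F x (τ x) v • τ x + eigenProj ε F τ l₂ l₃ x v + eigenProj ε F τ l₃ l₂ x v := by
  obtain ⟨a, ha, b, hb, h⟩ := S.exists_decomposition hx v
  generalize metric ε F x (τ x) v = c at h
  subst h
  have hswap := S.swap.eigenProj_add hx c hb ha
  rw [add_right_comm] at hswap
  rw [S.eigenProj_add hx _ ha hb, hswap]

theorem contDiffAt_eigenProj : ContDiffAt ℝ ∞ (eigenProj ε F τ l₂ l₃) x := by
  have hτ := S.contDiffAt_field hx
  exact ((((S.contDiffAt_difference hx).clm_apply hτ).sub contDiffAt_const).sub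
    ((((S.contDiffAt_metric hx).clm_apply hτ).smulRight hτ).const_smul l₂)).const_smul _

/-- The projection is parallel, because `τ`, `h` and `K` are. -/
theorem fderiv_eigenProj (u v : Euc n) :
    fderiv ℝ (eigenProj ε F τ l₂ l₃) x u v =
      eigenProj ε F τ l₂ l₃ x (christoffel (metric ε F) x u v)
        - christoffel (metric ε F) x u (eigenProj ε F τ l₂ l₃ x v) := by
  have hK := hasFDerivAt_clm_apply_const (S.hasFDerivAt_difference_field hx) v
  have hh := hasFDerivAt_clm_apply_const (S.hasFDerivAt_metric_field hx) v
  have h := hasFDerivAt_unique_of_eqOn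
    (hasFDerivAt_clm_apply_const (hasFDerivAt_of_contDiffAt_infty (S.contDiffAt_eigenProj hx)) v)
    (((hK.sub (hasFDerivAt_const (l₃ • v) x)).sub
      ((hh.const_mul l₂).smul (S.hasFDerivAt_field hx))).const_smul (l₂ - l₃)⁻¹) S.isOpen hx
    (fun y _ => eigenProj_apply ε F τ l₂ l₃ y v) u
  simp only [add_apply, sub_apply, neg_apply, smul_apply, zero_apply, smul_eq_mul,
    ContinuousLinearMap.comp_apply, ContinuousLinearMap.flip_apply,
    ContinuousLinearMap.compL_apply, ContinuousLinearMap.smulRight_apply] at h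
  rw [h, eigenProj_apply, eigenProj_apply]
  simp only [map_sub, map_smul]
  module

variable {B : Euc (n + 1) →L[ℝ] Euc (n + 1)} (hB : Set.EqOn (imageField F τ) (B ∘ F) Ω)
include hB

theorem endomorphism_fderiv (v : Euc n) :
    B (fderiv ℝ F x v) =
      fderiv ℝ F x (difference ε F x (τ x) v) + metric ε F x (τ x) v • -(ε • F x) := by
  have h := hasFDerivAt_unique_of_eqOn (S.hasFDerivAt_imageField hx)
    (B.hasFDerivAt.comp x (S.hasFDerivAt hx)) S.isOpen hx hB v
  simpa [gaussFrame_apply] using h.symm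

theorem endomorphism_fderiv_of_mem {v : Euc n} (hv : v ∈ D₂ x) :
    B (fderiv ℝ F x v) = l₂ • fderiv ℝ F x v := by
  simp [S.endomorphism_fderiv hx hB, S.eigen₂ x hx v hv, S.orth₂ x hx v hv]

theorem endomorphism_sq : B (B (F x)) = (l₂ + l₃) • B (F x) - (l₂ * l₃) • F x := by
  have hfield : fderiv ℝ F x (τ x) = B (F x) := hB hx
  rw [← hfield, S.endomorphism_fderiv hx hB, S.eigen₁ x hx, S.unit x hx, S.eigenvalue_prod hx,
    ← S.eigenvalue_sum hx, map_smul]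
  module

theorem frame_independent {v : Euc n} (hv : v ∈ D₂ x) {c : ℝ}
    (h : c • (B (F x) - l₃ • F x) + fderiv ℝ F x v = 0) : c = 0 ∧ v = 0 := by
  have hfield : fderiv ℝ F x (τ x) = B (F x) := hB hx
  have hzero : gaussFrame ε F x (c • τ x + v + 0, c * l₃ / ε) = gaussFrame ε F x 0 := by
    rw [gaussFrame_apply, map_zero, ← h, smul_neg, smul_smul,
      div_mul_cancel₀ _ (S.sign_ne_zero hx), add_zero, map_add, map_smul, hfield]
    module
  have htangent := congrArg Prod.fst ((S.frame x hx).injective hzero)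
  obtain ⟨hc, hv0, -⟩ := S.components_eq_zero hx hv (zero_mem _) htangent
  exact ⟨hc, hv0⟩

theorem add_one_le_finrank_eigenspace :
    n₁ + 1 ≤ Module.finrank ℝ (Module.End.eigenspace (B : Module.End ℝ (Euc (n + 1))) l₂) := by
  let f : (ℝ × D₂ x) →ₗ[ℝ] Euc (n + 1) :=
    (LinearMap.toSpanSingleton ℝ (Euc (n + 1)) (B (F x) - l₃ • F x)).coprod
      ((fderiv ℝ F x : Euc n →ₗ[ℝ] Euc (n + 1)).comp (D₂ x).subtype)
  have hf : ∀ c v, f (c, v) = c • (B (F x) - l₃ • F x) + fderiv ℝ F x v := fun c v => by simp [f]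
  have hmem : ∀ p, f p ∈ Module.End.eigenspace (B : Module.End ℝ (Euc (n + 1))) l₂ := by
    rintro ⟨c, v⟩
    rw [Module.End.mem_eigenspace_iff, hf]
    simp only [ContinuousLinearMap.coe_coe, map_add, map_smul, map_sub,
      S.endomorphism_fderiv_of_mem hx hB v.2, S.endomorphism_sq hx hB]
    module
  have hinj : Function.Injective (f.codRestrict _ hmem) := by
    refine (injective_iff_map_eq_zero _).2 ?_
    rintro ⟨c, v⟩ h
    have hsum : c • (B (F x) - l₃ • F x) + fderiv ℝ F x v = 0 :=
      (hf c v).symm.trans (congrArg Subtype.val h)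
    obtain ⟨hc, hv⟩ := S.frame_independent hx hB v.2 hsum
    simp [hc, Subtype.ext_iff, hv]
  have hle := LinearMap.finrank_le_finrank_of_injective hinj
  rwa [Module.finrank_prod, Module.finrank_self, S.finrank₂ x hx, add_comm] at hle

variable {W : Type*} [NormedAddCommGroup W] [NormedSpace ℝ W] {A : Euc (n + 1) →L[ℝ] W}

theorem projection_fderiv (hA : ∀ z, A (B z) = l₂ • A z) (v : Euc n) :
    A (fderiv ℝ F x v) = A (fderiv ℝ F x (eigenProj ε F τ l₂ l₃ x v))
      + (l₂ * metric ε F x (τ x) v) • A (F x) := by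
  have hfield : fderiv ℝ F x (τ x) = B (F x) := hB hx
  have hvanish : A (fderiv ℝ F x (eigenProj ε F τ l₃ l₂ x v)) = 0 := by
    have h := hA (fderiv ℝ F x (eigenProj ε F τ l₃ l₂ x v))
    rw [S.swap.endomorphism_fderiv_of_mem hx hB (S.swap.eigenProj_mem hx v), map_smul,
      ← sub_eq_zero, ← sub_smul] at h
    exact (smul_eq_zero.1 h).resolve_left (sub_ne_zero.2 S.ne₂₃.symm)
  conv_lhs => rw [S.eq_add_eigenProj hx v]
  simp only [map_add, map_smul, hvanish, hfield, hA]
  module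

theorem projection_independent (hA : IsEigenProjection B l₂ A) {v : Euc n} (hv : v ∈ D₂ x) {c : ℝ}
    (h : A (fderiv ℝ F x v) + c • A (F x) = 0) : v = 0 ∧ c = 0 := by
  have hsum : c • (B (F x) - l₃ • F x) + fderiv ℝ F x ((l₂ - l₃) • v) = 0 := by
    refine hA.injective _ ?_ ?_
    · simp only [map_smul, map_add, map_sub, S.endomorphism_fderiv_of_mem hx hB hv,
        S.endomorphism_sq hx hB]
      module
    · simp only [map_smul, map_add, map_sub, hA.map]
      linear_combination (norm := module) (l₂ - l₃) • h
  obtain ⟨hc, hv0⟩ := S.frame_independent hx hB ((D₂ x).smul_mem _ hv) hsum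
  exact ⟨(smul_eq_zero.1 hv0).resolve_left (sub_ne_zero.2 S.ne₂₃), hc⟩

end EigenSplitting
end EigenProjections

/-! ### Leaves and their images -/

section Eigenvalues

variable {n : ℕ} {ε : ℝ} {F : Euc n → Euc (n + 1)} {Ω : Set (Euc n)} {τ : Euc n → Euc n}
  {D₂ D₃ : Euc n → Submodule ℝ (Euc n)} {n₁ n₂ : ℕ} {l₁ l₂ l₃ : ℝ}
  (S : EigenSplitting ε F Ω τ D₂ D₃ n₁ n₂ l₁ l₂ l₃) {x : Euc n} (hx : x ∈ Ω)
include S hx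

theorem EigenSplitting.eigenvalue_ne_zero : l₂ ≠ 0 :=
  left_ne_zero_of_mul ((S.eigenvalue_prod hx).trans_ne (S.sign_ne_zero hx))

theorem EigenSplitting.sign_sub_eigenvalue_sq_ne_zero : ε - l₂ ^ 2 ≠ 0 := by
  have h : ε - l₂ ^ 2 = l₂ * (l₃ - l₂) := by rw [← S.eigenvalue_prod hx]; ring
  rw [h]
  exact mul_ne_zero (S.eigenvalue_ne_zero hx) (sub_ne_zero.2 S.ne₂₃.symm)

end Eigenvalues

noncomputable section Leaves

variable {n k : ℕ}

theorem ConvexParam.cubicForm_eq {ε : ℝ} {F : Euc n → Euc (n + 1)} {Ω : Set (Euc n)}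
    (H : ConvexParam ε F Ω) {x : Euc n} (hx : x ∈ Ω) (u v w : Euc n) :
    cubicForm ε F x u v w = -2 * metric ε F x (difference ε F x u v) w := by
  have h := hasFDerivAt_clm_apply_const
    (hasFDerivAt_clm_apply_const (H.hasFDerivAt_metric hx) v) w
  have hsymm : metric ε F x v (difference ε F x u w) = metric ε F x (difference ε F x u v) w := by
    rw [H.difference_comm hx u w, H.metric_difference_comm hx, H.metric_comm hx,
      H.difference_comm hx v u]
  simp only [cubicForm, h.fderiv, ContinuousLinearMap.flip_apply, H.fderiv_metric hx,
    inducedConnection_eq, add_apply, map_add, hsymm]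
  ring

/-- `j : U → Ω` parametrizes an integral manifold of the distribution `D`. -/
structure IsLeaf (D : Euc n → Submodule ℝ (Euc n)) (Ω : Set (Euc n)) (j : Euc k → Euc n)
    (U : Set (Euc k)) : Prop where
  isOpen : IsOpen U
  smooth : ContDiffOn ℝ ∞ j U
  mapsTo : Set.MapsTo j U Ω
  tangent : ∀ p ∈ U, ∀ v, fderiv ℝ j p v ∈ D (j p)
  injective : ∀ p ∈ U, ∀ v, fderiv ℝ j p v = 0 → v = 0

/-- The covariant derivative of `dj(v)` in the direction `dj(u)`, for the Levi-Civita connection of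
`g`. -/
def covDerivAlong (g : Euc n → Euc n →L[ℝ] Euc n →L[ℝ] ℝ) (j : Euc k → Euc n) (p u v : Euc k) :
    Euc n :=
  christoffel g (j p) (fderiv ℝ j p u) (fderiv ℝ j p v) + fderiv ℝ (fderiv ℝ j) p u v

namespace IsLeaf

section Distribution

variable {D : Euc n → Submodule ℝ (Euc n)} {Ω : Set (Euc n)} {j : Euc k → Euc n}
  {U : Set (Euc k)} (J : IsLeaf D Ω j U) {p : Euc k} (hp : p ∈ U)
include J hp

theorem contDiffAt : ContDiffAt ℝ ∞ j p :=
  J.smooth.contDiffAt (J.isOpen.mem_nhds hp)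

theorem hasFDerivAt : HasFDerivAt j (fderiv ℝ j p) p :=
  hasFDerivAt_of_contDiffAt_infty (J.contDiffAt hp)

theorem hasFDerivAt_fderiv_apply (v : Euc k) :
    HasFDerivAt (fun q => fderiv ℝ j q v) ((fderiv ℝ (fderiv ℝ j) p).flip v) p :=
  hasFDerivAt_clm_apply_const
    (hasFDerivAt_of_contDiffAt_infty (contDiffAt_infty_fderiv (J.contDiffAt hp))) v

theorem covDerivAlong_comm {ε : ℝ} {F : Euc n → Euc (n + 1)} (H : ConvexParam ε F Ω)
    (u v : Euc k) :
    covDerivAlong (metric ε F) j p u v = covDerivAlong (metric ε F) j p v u := by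
  rw [covDerivAlong, covDerivAlong, H.christoffel_comm (J.mapsTo hp),
    fderiv_fderiv_comm (J.contDiffAt hp)]

theorem exists_fderiv_eq (hD : Module.finrank ℝ (D (j p)) = k) {X : Euc n} (hX : X ∈ D (j p)) :
    ∃ v, fderiv ℝ j p v = X := by
  let f : Euc k →ₗ[ℝ] D (j p) :=
    (fderiv ℝ j p : Euc k →ₗ[ℝ] Euc n).codRestrict (D (j p)) (J.tangent p hp)
  have hinj : Function.Injective f := (injective_iff_map_eq_zero f).2 fun v hv =>
    J.injective p hp v (congrArg Subtype.val hv)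
  obtain ⟨v, hv⟩ := (LinearMap.injective_iff_surjective_of_finrank_eq_finrank
    (by rw [hD, finrank_euclideanSpace_fin])).1 hinj ⟨X, hX⟩
  exact ⟨v, congrArg Subtype.val hv⟩

end Distribution

section Splitting

variable {ε : ℝ} {F : Euc n → Euc (n + 1)} {Ω : Set (Euc n)} {τ : Euc n → Euc n}
  {D₂ D₃ : Euc n → Submodule ℝ (Euc n)} {n₁ n₂ : ℕ} {l₁ l₂ l₃ : ℝ} {j : Euc k → Euc n}
  {U : Set (Euc k)} (J : IsLeaf D₂ Ω j U) (S : EigenSplitting ε F Ω τ D₂ D₃ n₁ n₂ l₁ l₂ l₃)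
  {p : Euc k} (hp : p ∈ U)
include J S hp

/-- Leaves are totally geodesic, because the projection onto `D₂` is parallel. -/
theorem covDerivAlong_mem (u v : Euc k) : covDerivAlong (metric ε F) j p u v ∈ D₂ (j p) := by
  have hy := J.mapsTo hp
  have hP := hasFDerivAt_of_contDiffAt_infty (S.contDiffAt_eigenProj hy)
  have h := hasFDerivAt_unique_of_eqOn (J.hasFDerivAt_fderiv_apply hp v)
    ((hP.comp p (J.hasFDerivAt hp)).clm_apply (J.hasFDerivAt_fderiv_apply hp v)) J.isOpen hp
    (fun q hq => (S.eigenProj_of_mem (J.mapsTo hq) (J.tangent q hq v)).symm) u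
  simp only [add_apply, ContinuousLinearMap.comp_apply, ContinuousLinearMap.flip_apply,
    Function.comp_apply, S.fderiv_eigenProj hy, S.eigenProj_of_mem hy (J.tangent p hp v)] at h
  have hfixed : covDerivAlong (metric ε F) j p u v =
      eigenProj ε F τ l₂ l₃ (j p) (covDerivAlong (metric ε F) j p u v) := by
    rw [covDerivAlong, map_add]
    linear_combination (norm := module) h
  rw [hfixed]
  exact S.eigenProj_mem hy _

end Splitting

section Image

variable {ε : ℝ} {F : Euc n → Euc (n + 1)} {Ω : Set (Euc n)} {τ : Euc n → Euc n}
  {D₂ D₃ : Euc n → Submodule ℝ (Euc n)} {n₁ n₂ : ℕ} {l₁ l₂ l₃ : ℝ}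
  {j : Euc n₁ → Euc n} {U : Set (Euc n₁)} (J : IsLeaf D₂ Ω j U)

section Derivatives

variable {W : Type*} [NormedAddCommGroup W] [NormedSpace ℝ W] (A : Euc (n + 1) →L[ℝ] W)
  (H : ConvexParam ε F Ω)
include J H

theorem contDiffOn_image : ContDiffOn ℝ ∞ (A ∘ F ∘ j) U :=
  A.contDiff.comp_contDiffOn (H.smooth.comp J.smooth J.mapsTo)

variable {p : Euc n₁} (hp : p ∈ U)
include hp

theorem fderiv_image (v : Euc n₁) :
    fderiv ℝ (A ∘ F ∘ j) p v = A (fderiv ℝ F (j p) (fderiv ℝ j p v)) :=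
  DFunLike.congr_fun (A.hasFDerivAt.comp p
    ((H.hasFDerivAt (J.mapsTo hp)).comp p (J.hasFDerivAt hp))).fderiv v

theorem fderiv_fderiv_image (u v : Euc n₁) :
    fderiv ℝ (fderiv ℝ (A ∘ F ∘ j)) p u v = A (fderiv ℝ F (j p)
      (difference ε F (j p) (fderiv ℝ j p u) (fderiv ℝ j p v)
        + covDerivAlong (metric ε F) j p u v)
      + metric ε F (j p) (fderiv ℝ j p u) (fderiv ℝ j p v) • -(ε • F (j p))) := by
  have hy := J.mapsTo hp
  have himage := hasFDerivAt_clm_apply_const (hasFDerivAt_of_contDiffAt_infty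
    (contDiffAt_infty_fderiv ((J.contDiffOn_image A H).contDiffAt (J.isOpen.mem_nhds hp)))) v
  have hcomp := A.hasFDerivAt.comp p
    (((hasFDerivAt_of_contDiffAt_infty (H.contDiffAt_fderiv hy)).comp p
      (J.hasFDerivAt hp)).clm_apply (J.hasFDerivAt_fderiv_apply hp v))
  have h := hasFDerivAt_unique_of_eqOn himage hcomp J.isOpen hp
    (fun q hq => J.fderiv_image A H hq v) u
  simp only [add_apply, ContinuousLinearMap.comp_apply, ContinuousLinearMap.flip_apply,
    Function.comp_apply, gauss_formula (H.frame _ hy), inducedConnection_eq, gaussFrame_apply] at h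
  rw [h, covDerivAlong]
  simp only [map_add, map_smul, map_neg]
  module

end Derivatives

variable (S : EigenSplitting ε F Ω τ D₂ D₃ n₁ n₂ l₁ l₂ l₃) {B : Euc (n + 1) →L[ℝ] Euc (n + 1)}
  (hB : Set.EqOn (imageField F τ) (B ∘ F) Ω) {A : Euc (n + 1) →L[ℝ] Euc (n₁ + 1)}
  (hA : IsEigenProjection B l₂ A) {c ε₁ : ℝ} (hc : c * ε₁ = ε - l₂ ^ 2) {p : Euc n₁}
include J S hB hA hc

theorem isInvertible_gaussFrame_image (hp : p ∈ U) :
    (gaussFrame ε₁ (A ∘ F ∘ j) p).IsInvertible := by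
  have hε₁ : ε₁ ≠ 0 :=
    right_ne_zero_of_mul (hc.trans_ne (S.sign_sub_eigenvalue_sq_ne_zero (J.mapsTo hp)))
  refine isInvertible_gaussFrame fun v s h => ?_
  rw [gaussFrame_apply, J.fderiv_image A S.toConvexParam hp, smul_neg, smul_smul,
    ← neg_smul] at h
  obtain ⟨hv, hs⟩ := S.projection_independent (J.mapsTo hp) hB hA (J.tangent p hp v) h
  exact ⟨J.injective p hp v hv, by simpa [hε₁] using hs⟩

/-- The position vector of the image contributes `l₂² h` to its second derivative, so that its
metric is a multiple of `(ε - l₂²) h`. -/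
theorem metric_and_connection_image (hp : p ∈ U) (u v : Euc n₁) :
    metric ε₁ (A ∘ F ∘ j) p u v = c * metric ε F (j p) (fderiv ℝ j p u) (fderiv ℝ j p v) ∧
    fderiv ℝ j p (inducedConnection ε₁ (A ∘ F ∘ j) p u v) =
      eigenProj ε F τ l₂ l₃ (j p) (difference ε F (j p) (fderiv ℝ j p u) (fderiv ℝ j p v))
      + covDerivAlong (metric ε F) j p u v := by
  have hy := J.mapsTo hp
  have hZ := J.covDerivAlong_mem S hp u v
  set h := metric ε F (j p) (fderiv ℝ j p u) (fderiv ℝ j p v) with hh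
  set K := difference ε F (j p) (fderiv ℝ j p u) (fderiv ℝ j p v) with hK
  set Z := covDerivAlong (metric ε F) j p u v with hZdef
  obtain ⟨z, hz⟩ := J.exists_fderiv_eq hp (S.finrank₂ _ hy)
    ((D₂ (j p)).add_mem (S.eigenProj_mem hy K) hZ)
  have hτ : metric ε F (j p) (τ (j p)) (K + Z) = l₂ * h := by
    rw [map_add, S.orth₂ _ hy _ hZ, hK, S.metric_difference_comm hy,
      S.eigen₂ _ hy _ (J.tangent p hp v), map_smul, smul_eq_mul, add_zero]
  have hgauss : fderiv ℝ (fderiv ℝ (A ∘ F ∘ j)) p u v =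
      gaussFrame ε₁ (A ∘ F ∘ j) p (z, c * h) := by
    rw [J.fderiv_fderiv_image A S.toConvexParam hp, ← hh, ← hK, ← hZdef, gaussFrame_apply,
      J.fderiv_image A S.toConvexParam hp, hz, map_add A, S.projection_fderiv hy hB hA.map, hτ,
      map_add (eigenProj ε F τ l₂ l₃ (j p)), S.eigenProj_of_mem hy hZ]
    simp only [map_smul, map_neg, Function.comp_apply]
    linear_combination (norm := module) h • hc • A (F (j p))
  obtain ⟨hmetric, hconn⟩ := gauss_components (J.isInvertible_gaussFrame_image S hB hA hc hp) hgauss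
  exact ⟨hmetric, by rw [hconn, hz]⟩

theorem metric_image (hp : p ∈ U) (u v : Euc n₁) :
    metric ε₁ (A ∘ F ∘ j) p u v = c * metric ε F (j p) (fderiv ℝ j p u) (fderiv ℝ j p v) :=
  (J.metric_and_connection_image S hB hA hc hp u v).1

variable (hc₀ : 0 < c)
include hc₀

theorem convexParam_image : ConvexParam ε₁ (A ∘ F ∘ j) U where
  isOpen := J.isOpen
  smooth := J.contDiffOn_image A S.toConvexParam
  frame _ hp := J.isInvertible_gaussFrame_image S hB hA hc hp
  pos p hp v hv := by
    rw [J.metric_image S hB hA hc hp]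
    exact mul_pos hc₀ (S.pos _ (J.mapsTo hp) _ fun h => hv (J.injective p hp v h))

variable (hp : p ∈ U)
include hp

theorem fderiv_metric_image (u v w : Euc n₁) :
    fderiv ℝ (metric ε₁ (A ∘ F ∘ j)) p u v w =
      c * (metric ε F (j p) (covDerivAlong (metric ε F) j p u v) (fderiv ℝ j p w)
        + metric ε F (j p) (fderiv ℝ j p v) (covDerivAlong (metric ε F) j p u w)) := by
  have hy := J.mapsTo hp
  have himage := hasFDerivAt_clm_apply_const (hasFDerivAt_clm_apply_const
    ((J.convexParam_image S hB hA hc hc₀).hasFDerivAt_metric hp) v) w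
  have hpullback := ((((S.hasFDerivAt_metric hy).comp p (J.hasFDerivAt hp)).clm_apply
    (J.hasFDerivAt_fderiv_apply hp v)).clm_apply (J.hasFDerivAt_fderiv_apply hp w)).const_mul c
  have h := hasFDerivAt_unique_of_eqOn himage hpullback J.isOpen hp
    (fun q hq => J.metric_image S hB hA hc hq v w) u
  simp only [add_apply, smul_apply, ContinuousLinearMap.comp_apply, ContinuousLinearMap.flip_apply,
    Function.comp_apply, S.fderiv_metric hy, smul_eq_mul] at h
  simp only [h, covDerivAlong, map_add, add_apply]
  ring

theorem fderiv_christoffel_image (u v : Euc n₁) :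
    fderiv ℝ j p (christoffel (metric ε₁ (A ∘ F ∘ j)) p u v) =
      covDerivAlong (metric ε F) j p u v := by
  have H := J.convexParam_image S hB hA hc hc₀
  have hy := J.mapsTo hp
  obtain ⟨z, hz⟩ := J.exists_fderiv_eq hp (S.finrank₂ _ hy) (J.covDerivAlong_mem S hp u v)
  suffices h : christoffel (metric ε₁ (A ∘ F ∘ j)) p u v = z by rw [h, hz]
  refine H.eq_of_metric_eq hp fun w => ?_
  simp only [H.metric_christoffel hp, J.fderiv_metric_image S hB hA hc hc₀ hp,
    J.metric_image S hB hA hc hp, hz]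
  rw [J.covDerivAlong_comm hp S.toConvexParam v u, J.covDerivAlong_comm hp S.toConvexParam w u,
    J.covDerivAlong_comm hp S.toConvexParam w v, S.metric_comm hy (fderiv ℝ j p u),
    S.metric_comm hy (fderiv ℝ j p v)]
  ring

theorem cubicForm_image (u v w : Euc n₁) :
    cubicForm ε₁ (A ∘ F ∘ j) p u v w = (-2 * c) * metric ε F (j p)
      (difference ε F (j p) (fderiv ℝ j p u) (fderiv ℝ j p v)) (fderiv ℝ j p w) := by
  have hy := J.mapsTo hp
  have hdiff : fderiv ℝ j p (difference ε₁ (A ∘ F ∘ j) p u v) =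
      eigenProj ε F τ l₂ l₃ (j p) (difference ε F (j p) (fderiv ℝ j p u) (fderiv ℝ j p v)) := by
    rw [difference, sub_apply, sub_apply, map_sub,
      (J.metric_and_connection_image S hB hA hc hp u v).2,
      J.fderiv_christoffel_image S hB hA hc hc₀ hp, add_sub_cancel_right]
  rw [(J.convexParam_image S hB hA hc hc₀).cubicForm_eq hp, J.metric_image S hB hA hc hp, hdiff,
    S.metric_eigenProj hy _ (J.tangent p hp w)]
  ring

theorem covDerivCubicForm_image (u v w z : Euc n₁) :
    covDerivCubicForm ε₁ (A ∘ F ∘ j) p u v w z = 0 := by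
  have hy := J.mapsTo hp
  have hK := (((S.hasFDerivAt_difference hy).comp p (J.hasFDerivAt hp)).clm_apply
    (J.hasFDerivAt_fderiv_apply hp v)).clm_apply (J.hasFDerivAt_fderiv_apply hp w)
  have hC := ((((S.hasFDerivAt_metric hy).comp p (J.hasFDerivAt hp)).clm_apply hK).clm_apply
    (J.hasFDerivAt_fderiv_apply hp z)).const_mul (-2 * c)
  have h := (hC.congr_of_eventuallyEq (Filter.eventually_of_mem (J.isOpen.mem_nhds hp) fun q hq =>
    J.cubicForm_image S hB hA hc hc₀ hq v w z)).fderiv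
  rw [covDerivCubicForm, h]
  simp only [← christoffel_metric_apply, J.cubicForm_image S hB hA hc hc₀ hp,
    J.fderiv_christoffel_image S hB hA hc hc₀ hp]
  simp only [covDerivAlong, add_apply, smul_apply, ContinuousLinearMap.comp_apply,
    ContinuousLinearMap.flip_apply, Function.comp_apply, S.fderiv_metric hy,
    S.fderiv_difference hy (S.parallel _ hy _ _ _), smul_eq_mul, map_add, map_sub, sub_apply]
  ring

end Image
end IsLeaf
end Leaves

section InverseFunction

variable {E : Type*} [NormedAddCommGroup E] [NormedSpace ℝ E]

theorem exists_openPartialHomeomorph_of_isInvertible [CompleteSpace E] {G : Type*}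
    [NormedAddCommGroup G] [NormedSpace ℝ G] {f : E → G} {Ω : Set E} (hΩ : IsOpen Ω)
    (hf : ContDiffOn ℝ ∞ f Ω) {x : E} (hx : x ∈ Ω) (hinv : (fderiv ℝ f x).IsInvertible) :
    ∃ R : OpenPartialHomeomorph E G, ⇑R = f ∧ x ∈ R.source ∧ R.source ⊆ Ω ∧
      ContDiffOn ℝ ∞ R.symm R.target ∧ ∀ y ∈ R.source, (fderiv ℝ f y).IsInvertible := by
  have hat : ∀ y ∈ Ω, ContDiffAt ℝ ∞ f y := fun y hy => hf.contDiffAt (hΩ.mem_nhds hy)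
  obtain ⟨f', hf'⟩ := hinv
  have hderiv : HasFDerivAt f (f' : E →L[ℝ] G) x :=
    hf' ▸ hasFDerivAt_of_contDiffAt_infty (hat x hx)
  have hnear : ∀ᶠ y in nhds x, y ∈ Ω ∧ (fderiv ℝ f y).IsInvertible :=
    (hΩ.eventually_mem hx).and ((contDiffAt_infty_fderiv (hat x hx)).continuousAt.eventually
      (hf' ▸ f'.nhds))
  obtain ⟨N, hN, hNopen, hxN⟩ := eventually_nhds_iff.1 hnear
  let R := ((hat x hx).toOpenPartialHomeomorph f hderiv (by simp)).restrOpen N hNopen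
  have hRN : ∀ y ∈ R.source, y ∈ N := fun y hy => hy.2
  refine ⟨R, rfl, ⟨(hat x hx).mem_toOpenPartialHomeomorph_source hderiv (by simp), hxN⟩,
    fun y hy => (hN y (hRN y hy)).1, fun z hz => ?_, fun y hy => (hN y (hRN y hy)).2⟩
  obtain ⟨hmem, e, he⟩ := hN _ (hRN _ (R.map_target hz))
  exact (R.contDiffAt_symm hz (he ▸ hasFDerivAt_of_contDiffAt_infty (hat _ hmem))
    (hat _ hmem)).contDiffWithinAt

variable {E₁ E₂ : Type*} [NormedAddCommGroup E₁] [NormedSpace ℝ E₁] [NormedAddCommGroup E₂]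
  [NormedSpace ℝ E₂]

/-- `Ψ` is a diffeomorphism from the product `J × U₁ × U₂` onto a neighbourhood of `x` contained in
`Ω`. -/
structure IsProductChart (Ψ : OpenPartialHomeomorph (ℝ × E₁ × E₂) E) (Ω : Set E) (x : E)
    (J : Set ℝ) (U₁ : Set E₁) (U₂ : Set E₂) : Prop where
  source_eq : Ψ.source = J ×ˢ U₁ ×ˢ U₂
  target_subset : Ψ.target ⊆ Ω
  mem_target : x ∈ Ψ.target
  smooth : ContDiffOn ℝ ∞ Ψ Ψ.source
  smooth_symm : ContDiffOn ℝ ∞ Ψ.symm Ψ.target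

theorem exists_isProductChart [CompleteSpace E] {Θ : E → ℝ × E₁ × E₂} {Ω : Set E}
    (hΩ : IsOpen Ω) (hΘ : ContDiffOn ℝ ∞ Θ Ω) {x : E} (hx : x ∈ Ω)
    (hinv : (fderiv ℝ Θ x).IsInvertible) :
    ∃ (r : ℝ) (Ψ : OpenPartialHomeomorph (ℝ × E₁ × E₂) E),
      IsProductChart Ψ Ω x (Metric.ball (Θ x).1 r) (Metric.ball (Θ x).2.1 r)
        (Metric.ball (Θ x).2.2 r) ∧
      ∀ z ∈ Ψ.source, Θ (Ψ z) = z ∧ (fderiv ℝ Θ (Ψ z)).IsInvertible := by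
  obtain ⟨R, rfl, hxR, hRΩ, hsymm, hRinv⟩ :=
    exists_openPartialHomeomorph_of_isInvertible hΩ hΘ hx hinv
  obtain ⟨r, hr, hball⟩ := Metric.isOpen_iff.1 R.open_target (R x) (R.map_source hxR)
  let Ψ := R.symm.restrOpen (Metric.ball (R x) r) Metric.isOpen_ball
  have hsource : Ψ.source = Metric.ball (R x) r := Set.inter_eq_right.2 hball
  have hmaps : ∀ z ∈ Ψ.source, Ψ z ∈ R.source := fun z hz => R.map_target hz.1
  have htarget : Ψ.target ⊆ Ω := fun y hy => hRΩ (Ψ.right_inv hy ▸ hmaps _ (Ψ.map_target hy))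
  have hmem : R x ∈ Ψ.source := hsource ▸ Metric.mem_ball_self hr
  refine ⟨r, Ψ, ⟨?_, htarget, R.left_inv hxR ▸ Ψ.map_source hmem, ?_, hΘ.mono htarget⟩,
    fun z hz => ⟨R.right_inv hz.1, hRinv _ (hmaps z hz)⟩⟩
  · rw [hsource, ball_prod_same, ball_prod_same]
  · exact hsymm.mono fun z hz => hz.1

end InverseFunction

noncomputable section Components

variable {n : ℕ}

/-- `G` parametrizes a locally strongly convex centroaffine hypersurface with parallel cubic
form. -/
structure ParallelConvexParam (ε : ℝ) (G : Euc n → Euc (n + 1)) (U : Set (Euc n)) : Prop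
    extends ConvexParam ε G U where
  sign : ε = 1 ∨ ε = -1
  parallel : ∀ p ∈ U, ∀ u v w z, covDerivCubicForm ε G p u v w z = 0

/-- The image of `F` under `A`, normalized so that it is constant in the direction of `τ` when `A`
takes values in an eigenspace for `l`; here `t` is a function with gradient `τ`. -/
def component {W : Type*} [NormedAddCommGroup W] [NormedSpace ℝ W] (F : Euc n → Euc (n + 1))
    (t : Euc n → ℝ) (l : ℝ) (A : Euc (n + 1) →L[ℝ] W) (x : Euc n) : W :=
  Real.exp (-(l * t x)) • A (F x)

variable {ε : ℝ} {F : Euc n → Euc (n + 1)} {Ω : Set (Euc n)} {τ : Euc n → Euc n}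
  {D₂ D₃ : Euc n → Submodule ℝ (Euc n)} {n₁ n₂ : ℕ} {l₁ l₂ l₃ : ℝ}

theorem IsLeaf.exists_parallelConvexParam_image {j : Euc n₁ → Euc n} {U : Set (Euc n₁)}
    (J : IsLeaf D₂ Ω j U) (S : EigenSplitting ε F Ω τ D₂ D₃ n₁ n₂ l₁ l₂ l₃) {x : Euc n}
    (hx : x ∈ Ω) {B : Euc (n + 1) →L[ℝ] Euc (n + 1)} (hB : Set.EqOn (imageField F τ) (B ∘ F) Ω)
    {A : Euc (n + 1) →L[ℝ] Euc (n₁ + 1)} (hA : IsEigenProjection B l₂ A) :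
    ∃ ε₁ : ℝ, ParallelConvexParam ε₁ (A ∘ F ∘ j) U := by
  obtain ⟨ε₁, c, hsign, hc₀, hc⟩ :
      ∃ ε₁ c : ℝ, (ε₁ = 1 ∨ ε₁ = -1) ∧ 0 < c ∧ c * ε₁ = ε - l₂ ^ 2 := by
    rcases lt_or_gt_of_ne (S.sign_sub_eigenvalue_sq_ne_zero hx) with h | h
    · exact ⟨-1, -(ε - l₂ ^ 2), Or.inr rfl, neg_pos.2 h, by ring⟩
    · exact ⟨1, ε - l₂ ^ 2, Or.inl rfl, h, mul_one _⟩
  exact ⟨ε₁, { J.convexParam_image S hB hA hc hc₀ with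
    sign := hsign
    parallel := fun p hp => J.covDerivCubicForm_image S hB hA hc hc₀ hp }⟩

namespace EigenSplitting

variable (S : EigenSplitting ε F Ω τ D₂ D₃ n₁ n₂ l₁ l₂ l₃)
include S

theorem exists_potential (hΩ : Convex ℝ Ω) :
    ∃ t : Euc n → ℝ, ∀ x ∈ Ω, HasFDerivAt t (metric ε F x (τ x)) x := by
  refine hΩ.exists_forall_hasFDerivAt_of_fderiv_symmetric S.isOpen
    (fun x hx => (S.hasFDerivAt_metric_field hx).differentiableAt.differentiableWithinAt)
    fun x hx u v => ?_
  simp [(S.hasFDerivAt_metric_field hx).fderiv, S.christoffel_comm hx u v]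

section Potential

variable {t : Euc n → ℝ} (ht : ∀ x ∈ Ω, HasFDerivAt t (metric ε F x (τ x)) x)
include ht

theorem contDiffOn_potential : ContDiffOn ℝ ∞ t Ω := by
  refine (contDiffOn_infty_iff_fderiv_of_isOpen S.isOpen).2
    ⟨fun x hx => (ht x hx).differentiableAt.differentiableWithinAt, ?_⟩
  have hdual : ContDiffOn ℝ ∞ (fun x => metric ε F x (τ x)) Ω := fun x hx =>
    ((S.contDiffAt_metric hx).clm_apply (S.contDiffAt_field hx)).contDiffWithinAt
  exact hdual.congr fun x hx => (ht x hx).fderiv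

variable {W : Type*} [NormedAddCommGroup W] [NormedSpace ℝ W]

theorem contDiffOn_component (l : ℝ) (A : Euc (n + 1) →L[ℝ] W) :
    ContDiffOn ℝ ∞ (component F t l A) Ω :=
  (contDiffOn_const.mul (S.contDiffOn_potential ht)).neg.exp.smul
    (A.contDiff.comp_contDiffOn S.smooth)

variable {B : Euc (n + 1) →L[ℝ] Euc (n + 1)} (hB : Set.EqOn (imageField F τ) (B ∘ F) Ω)
  {A : Euc (n + 1) →L[ℝ] W} (hA : ∀ z, A (B z) = l₂ • A z)
include hB hA

theorem hasFDerivAt_component {x : Euc n} (hx : x ∈ Ω) :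
    HasFDerivAt (component F t l₂ A)
      (Real.exp (-(l₂ * t x)) • A.comp ((fderiv ℝ F x).comp (eigenProj ε F τ l₂ l₃ x))) x := by
  refine (((ht x hx).const_mul l₂).neg.exp.smul
    (A.hasFDerivAt.comp x (S.hasFDerivAt hx))).congr_fderiv ?_
  ext1 v
  simp only [add_apply, smul_apply, neg_apply, ContinuousLinearMap.comp_apply,
    ContinuousLinearMap.smulRight_apply, Function.comp_apply, smul_eq_mul,
    S.projection_fderiv hx hB hA v]
  module

theorem component_eq_of_eigenProj_eq_zero {Y : Type*} [NormedAddCommGroup Y] [NormedSpace ℝ Y]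
    {γ : Y → Euc n} {V : Set Y} (hV : IsOpen V) (hconn : IsPreconnected V)
    (hγ : Set.MapsTo γ V Ω) (hd : ∀ y ∈ V, DifferentiableAt ℝ γ y)
    (hproj : ∀ y ∈ V, ∀ v, eigenProj ε F τ l₂ l₃ (γ y) (fderiv ℝ γ y v) = 0)
    {y z : Y} (hy : y ∈ V) (hz : z ∈ V) :
    component F t l₂ A (γ y) = component F t l₂ A (γ z) := by
  have hderiv : ∀ y ∈ V, HasFDerivAt (component F t l₂ A ∘ γ) (0 : Y →L[ℝ] W) y := fun y hy => by
    refine ((S.hasFDerivAt_component ht hB hA (hγ hy)).comp y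
      (hd y hy).hasFDerivAt).congr_fderiv ?_
    ext1 v
    simp [hproj y hy]
  exact hV.is_const_of_fderiv_eq_zero (𝕜 := ℝ) hconn
    (fun y hy => (hderiv y hy).differentiableAt.differentiableWithinAt)
    (fun y hy => (hderiv y hy).fderiv) hy hz

end Potential

theorem exists_transverse_functional {B : Euc (n + 1) →L[ℝ] Euc (n + 1)}
    (hB : Set.EqOn (imageField F τ) (B ∘ F) Ω) {W : Type*} [NormedAddCommGroup W]
    [NormedSpace ℝ W] [FiniteDimensional ℝ W] {A : Euc (n + 1) →L[ℝ] W}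
    (hA : IsEigenProjection B l₂ A) {x : Euc n} (hx : x ∈ Ω) :
    ∃ L : Euc (n + 1) →L[ℝ] Euc n₁, (∀ z, L (B z) = l₂ • L z) ∧
      ∀ v ∈ D₂ x, L (fderiv ℝ F x v) = 0 → v = 0 := by
  let g : D₂ x →ₗ[ℝ] W := (A.comp (fderiv ℝ F x) : Euc n →ₗ[ℝ] W).comp (D₂ x).subtype
  have hg : g.ker = ⊥ := LinearMap.ker_eq_bot'.2 fun v hv => by
    have hAv : A (fderiv ℝ F x v) = 0 := hv
    exact Subtype.ext (S.projection_independent (c := 0) hx hB hA v.2 (by simp [hAv])).1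
  obtain ⟨r, hr⟩ := g.exists_leftInverse_of_injective hg
  let e : D₂ x ≃ₗ[ℝ] Euc n₁ :=
    LinearEquiv.ofFinrankEq _ _ (by rw [S.finrank₂ x hx, finrank_euclideanSpace_fin])
  let π : W →L[ℝ] Euc n₁ := LinearMap.toContinuousLinearMap ((e : D₂ x →ₗ[ℝ] Euc n₁).comp r)
  refine ⟨π.comp A, fun z => by simp [hA.map], fun v hv h => ?_⟩
  have hπ : π (A (fderiv ℝ F x v)) = e ⟨v, hv⟩ :=
    congrArg e (LinearMap.congr_fun hr (⟨v, hv⟩ : D₂ x))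
  exact congrArg Subtype.val (e.map_eq_zero_iff.1 (hπ.symm.trans h))

end EigenSplitting
end Components

/-! ### Calabi coordinates -/

section AdaptedParametrizations

variable {n m₁ m₂ : ℕ}

/-- The coordinate directions of the parametrization `Ψ` are `τ`, `D₂` and `D₃`. -/
structure IsAdapted (τ : Euc n → Euc n) (D₂ D₃ : Euc n → Submodule ℝ (Euc n)) (Ω : Set (Euc n))
    (Ψ : ℝ × Euc m₁ × Euc m₂ → Euc n) (J : Set ℝ) (U₁ : Set (Euc m₁)) (U₂ : Set (Euc m₂)) :
    Prop where
  isOpen : IsOpen J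
  isOpen₁ : IsOpen U₁
  isOpen₂ : IsOpen U₂
  preconnected : IsPreconnected J
  preconnected₁ : IsPreconnected U₁
  preconnected₂ : IsPreconnected U₂
  smooth : ContDiffOn ℝ ∞ Ψ (J ×ˢ U₁ ×ˢ U₂)
  mapsTo : Set.MapsTo Ψ (J ×ˢ U₁ ×ˢ U₂) Ω
  injective : ∀ z ∈ J ×ˢ U₁ ×ˢ U₂, ∀ X, fderiv ℝ Ψ z X = 0 → X = 0
  time : ∀ z ∈ J ×ˢ U₁ ×ˢ U₂, ∀ s, ∃ c : ℝ, fderiv ℝ Ψ z (s, 0, 0) = c • τ (Ψ z)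
  first : ∀ z ∈ J ×ˢ U₁ ×ˢ U₂, ∀ v, fderiv ℝ Ψ z (0, v, 0) ∈ D₂ (Ψ z)
  second : ∀ z ∈ J ×ˢ U₁ ×ˢ U₂, ∀ w, fderiv ℝ Ψ z (0, 0, w) ∈ D₃ (Ψ z)

namespace IsAdapted

variable {ε : ℝ} {F : Euc n → Euc (n + 1)} {Ω : Set (Euc n)} {τ : Euc n → Euc n}
  {D₂ D₃ : Euc n → Submodule ℝ (Euc n)} {n₁ n₂ : ℕ} {l₁ l₂ l₃ : ℝ}
  {Ψ : ℝ × Euc m₁ × Euc m₂ → Euc n} {J : Set ℝ} {U₁ : Set (Euc m₁)} {U₂ : Set (Euc m₂)}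
  (P : IsAdapted τ D₂ D₃ Ω Ψ J U₁ U₂)
include P

theorem hasFDerivAt {z : ℝ × Euc m₁ × Euc m₂} (hz : z ∈ J ×ˢ U₁ ×ˢ U₂) :
    HasFDerivAt Ψ (fderiv ℝ Ψ z) z :=
  hasFDerivAt_of_contDiffAt_infty
    (P.smooth.contDiffAt ((P.isOpen.prod (P.isOpen₁.prod P.isOpen₂)).mem_nhds hz))

theorem swap : IsAdapted τ D₃ D₂ Ω (fun z => Ψ (z.1, z.2.2, z.2.1)) J U₂ U₁ := by
  let σ : (ℝ × Euc m₂ × Euc m₁) ≃L[ℝ] ℝ × Euc m₁ × Euc m₂ :=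
    (ContinuousLinearEquiv.refl ℝ ℝ).prodCongr (ContinuousLinearEquiv.prodComm ℝ _ _)
  have hσ : Set.MapsTo σ (J ×ˢ U₂ ×ˢ U₁) (J ×ˢ U₁ ×ˢ U₂) := fun z hz => ⟨hz.1, hz.2.2, hz.2.1⟩
  have hderiv : ∀ z X, fderiv ℝ (Ψ ∘ σ) z X = fderiv ℝ Ψ (σ z) (σ X) := fun z X => by
    rw [σ.comp_right_fderiv, ContinuousLinearMap.comp_apply, ContinuousLinearEquiv.coe_coe]
  exact {
    isOpen := P.isOpen
    isOpen₁ := P.isOpen₂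
    isOpen₂ := P.isOpen₁
    preconnected := P.preconnected
    preconnected₁ := P.preconnected₂
    preconnected₂ := P.preconnected₁
    smooth := P.smooth.comp σ.contDiff.contDiffOn hσ
    mapsTo := P.mapsTo.comp hσ
    injective := fun z hz X hX =>
      σ.map_eq_zero_iff.1 (P.injective _ (hσ hz) _ ((hderiv z X).symm.trans hX))
    time := fun z hz s => (P.time _ (hσ hz) s).imp fun _ h => (hderiv z _).trans h
    first := fun z hz v => (hderiv z (0, v, 0)).symm ▸ P.second _ (hσ hz) v
    second := fun z hz v => (hderiv z (0, 0, v)).symm ▸ P.first _ (hσ hz) v }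

theorem isLeaf {u : ℝ} (hu : u ∈ J) {q : Euc m₂} (hq : q ∈ U₂) :
    IsLeaf D₂ Ω (fun p => Ψ (u, p, q)) U₁ := by
  have hmap : Set.MapsTo (fun p : Euc m₁ => (u, p, q)) U₁ (J ×ˢ U₁ ×ˢ U₂) :=
    fun p hp => ⟨hu, hp, hq⟩
  have hderiv : ∀ p ∈ U₁, ∀ v,
      fderiv ℝ (fun p => Ψ (u, p, q)) p v = fderiv ℝ Ψ (u, p, q) (0, v, 0) := fun p hp v => by
    have hslice : HasFDerivAt (fun p : Euc m₁ => (u, p, q)) (ContinuousLinearMap.prod 0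
        (ContinuousLinearMap.inl ℝ (Euc m₁) (Euc m₂))) p :=
      (hasFDerivAt_const u p).prodMk (hasFDerivAt_prodMk_left p q)
    exact congrArg (· v) ((P.hasFDerivAt (hmap hp)).comp p hslice).fderiv
  exact {
    isOpen := P.isOpen₁
    smooth := P.smooth.comp (by fun_prop) hmap
    mapsTo := P.mapsTo.comp hmap
    tangent := fun p hp v => (hderiv p hp v).symm ▸ P.first _ (hmap hp) v
    injective := fun p hp v hv =>
      congrArg (fun X => X.2.1) (P.injective _ (hmap hp) _ ((hderiv p hp v).symm.trans hv)) }

theorem eigenProj_fderiv (S : EigenSplitting ε F Ω τ D₂ D₃ n₁ n₂ l₁ l₂ l₃)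
    {z : ℝ × Euc m₁ × Euc m₂} (hz : z ∈ J ×ˢ U₁ ×ˢ U₂) (s : ℝ) (w : Euc m₂) :
    eigenProj ε F τ l₂ l₃ (Ψ z) (fderiv ℝ Ψ z (s, 0, w)) = 0 := by
  obtain ⟨c, hc⟩ := P.time z hz s
  have hsum : fderiv ℝ Ψ z (s, 0, w) = c • τ (Ψ z) + 0 + fderiv ℝ Ψ z (0, 0, w) := by
    rw [← hc, add_zero, ← map_add]
    simp
  rw [hsum, S.eigenProj_add (P.mapsTo hz) c (zero_mem _) (P.second z hz w)]

theorem component_eq (S : EigenSplitting ε F Ω τ D₂ D₃ n₁ n₂ l₁ l₂ l₃)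
    {B : Euc (n + 1) →L[ℝ] Euc (n + 1)} (hB : Set.EqOn (imageField F τ) (B ∘ F) Ω)
    {t : Euc n → ℝ} (ht : ∀ x ∈ Ω, HasFDerivAt t (metric ε F x (τ x)) x) {W : Type*}
    [NormedAddCommGroup W] [NormedSpace ℝ W] {A : Euc (n + 1) →L[ℝ] W}
    (hA : ∀ z, A (B z) = l₂ • A z) {u u' : ℝ} (hu : u ∈ J) (hu' : u' ∈ J) {p : Euc m₁}
    (hp : p ∈ U₁) {q q' : Euc m₂} (hq : q ∈ U₂) (hq' : q' ∈ U₂) :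
    component F t l₂ A (Ψ (u, p, q)) = component F t l₂ A (Ψ (u', p, q')) := by
  have hmap : ∀ y ∈ J ×ˢ U₂, (y.1, p, y.2) ∈ J ×ˢ U₁ ×ˢ U₂ := fun y hy => ⟨hy.1, hp, hy.2⟩
  have hderiv : ∀ y ∈ J ×ˢ U₂, HasFDerivAt (fun y : ℝ × Euc m₂ => Ψ (y.1, p, y.2))
      ((fderiv ℝ Ψ (y.1, p, y.2)).comp ((ContinuousLinearMap.fst ℝ ℝ (Euc m₂)).prod
        ((0 : ℝ × Euc m₂ →L[ℝ] Euc m₁).prod (ContinuousLinearMap.snd ℝ ℝ (Euc m₂))))) y :=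
    fun y hy => (P.hasFDerivAt (hmap y hy)).comp y
      (hasFDerivAt_fst.prodMk ((hasFDerivAt_const p y).prodMk hasFDerivAt_snd))
  refine S.component_eq_of_eigenProj_eq_zero ht hB hA
    (γ := fun y : ℝ × Euc m₂ => Ψ (y.1, p, y.2)) (y := (u, q)) (z := (u', q'))
    (P.isOpen.prod P.isOpen₂) (P.preconnected.prod P.preconnected₂)
    (fun y hy => P.mapsTo (hmap y hy)) (fun y hy => (hderiv y hy).differentiableAt)
    (fun y hy v => ?_) ⟨hu, hq⟩ ⟨hu', hq'⟩
  rw [(hderiv y hy).fderiv]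
  exact P.eigenProj_fderiv S (hmap y hy) v.1 v.2

end IsAdapted
end AdaptedParametrizations

noncomputable section CalabiCoordinates

variable {n : ℕ}

/-- The coordinates `(l₂ t, e^(-l₂ t) L₁ F, e^(-l₃ t) L₂ F)`, in which `τ`, `D₂` and `D₃` are the
coordinate directions. -/
def coordinateMap {W₁ W₂ : Type*} [NormedAddCommGroup W₁] [NormedSpace ℝ W₁]
    [NormedAddCommGroup W₂] [NormedSpace ℝ W₂] (F : Euc n → Euc (n + 1)) (t : Euc n → ℝ)
    (l₂ l₃ : ℝ) (L₁ : Euc (n + 1) →L[ℝ] W₁) (L₂ : Euc (n + 1) →L[ℝ] W₂) (x : Euc n) :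
    ℝ × W₁ × W₂ :=
  (l₂ * t x, component F t l₂ L₁ x, component F t l₃ L₂ x)

namespace EigenSplitting

variable {ε : ℝ} {F : Euc n → Euc (n + 1)} {Ω : Set (Euc n)} {τ : Euc n → Euc n}
  {D₂ D₃ : Euc n → Submodule ℝ (Euc n)} {n₁ n₂ : ℕ} {l₁ l₂ l₃ : ℝ}
  (S : EigenSplitting ε F Ω τ D₂ D₃ n₁ n₂ l₁ l₂ l₃)
include S

section CoordinateMap

variable {t : Euc n → ℝ} (ht : ∀ x ∈ Ω, HasFDerivAt t (metric ε F x (τ x)) x)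
include ht

theorem contDiffOn_coordinateMap {W₁ W₂ : Type*} [NormedAddCommGroup W₁] [NormedSpace ℝ W₁]
    [NormedAddCommGroup W₂] [NormedSpace ℝ W₂] (L₁ : Euc (n + 1) →L[ℝ] W₁)
    (L₂ : Euc (n + 1) →L[ℝ] W₂) : ContDiffOn ℝ ∞ (coordinateMap F t l₂ l₃ L₁ L₂) Ω :=
  (contDiffOn_const.mul (S.contDiffOn_potential ht)).prodMk
    ((S.contDiffOn_component ht l₂ L₁).prodMk (S.contDiffOn_component ht l₃ L₂))

variable {W₁ W₂ : Type*} [NormedAddCommGroup W₁] [NormedSpace ℝ W₁]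
  [NormedAddCommGroup W₂] [NormedSpace ℝ W₂] {B : Euc (n + 1) →L[ℝ] Euc (n + 1)}
  (hB : Set.EqOn (imageField F τ) (B ∘ F) Ω)
  {L₁ : Euc (n + 1) →L[ℝ] W₁} (h₁ : ∀ z, L₁ (B z) = l₂ • L₁ z)
  {L₂ : Euc (n + 1) →L[ℝ] W₂} (h₂ : ∀ z, L₂ (B z) = l₃ • L₂ z)
include hB h₁ h₂

theorem fderiv_coordinateMap {x : Euc n} (hx : x ∈ Ω) (v : Euc n) :
    fderiv ℝ (coordinateMap F t l₂ l₃ L₁ L₂) x v = (l₂ * metric ε F x (τ x) v,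
      Real.exp (-(l₂ * t x)) • L₁ (fderiv ℝ F x (eigenProj ε F τ l₂ l₃ x v)),
      Real.exp (-(l₃ * t x)) • L₂ (fderiv ℝ F x (eigenProj ε F τ l₃ l₂ x v))) := by
  have h := ((ht x hx).const_mul l₂).prodMk ((S.hasFDerivAt_component ht hB h₁ hx).prodMk
    (S.swap.hasFDerivAt_component ht hB h₂ hx))
  exact congrArg (· v) h.fderiv

theorem injective_fderiv_coordinateMap {x : Euc n} (hx : x ∈ Ω)
    (hL₁ : ∀ v ∈ D₂ x, L₁ (fderiv ℝ F x v) = 0 → v = 0)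
    (hL₂ : ∀ v ∈ D₃ x, L₂ (fderiv ℝ F x v) = 0 → v = 0) :
    Function.Injective (fderiv ℝ (coordinateMap F t l₂ l₃ L₁ L₂) x) := by
  refine (injective_iff_map_eq_zero _).2 fun v hv => ?_
  rw [S.fderiv_coordinateMap ht hB h₁ h₂ hx] at hv
  simp only [Prod.mk_eq_zero, smul_eq_zero, Real.exp_ne_zero, mul_eq_zero,
    S.eigenvalue_ne_zero hx, false_or] at hv
  rw [S.eq_add_eigenProj hx v, hv.1, hL₁ _ (S.eigenProj_mem hx v) hv.2.1,
    hL₂ _ (S.swap.eigenProj_mem hx v) hv.2.2]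
  simp

theorem metric_eq_zero_of_fderiv_coordinateMap {x : Euc n} (hx : x ∈ Ω) {v : Euc n}
    (hv : (fderiv ℝ (coordinateMap F t l₂ l₃ L₁ L₂) x v).1 = 0) : metric ε F x (τ x) v = 0 := by
  rw [S.fderiv_coordinateMap ht hB h₁ h₂ hx] at hv
  exact (mul_eq_zero.1 hv).resolve_left (S.eigenvalue_ne_zero hx)

section Kernels

variable {x : Euc n} (hx : x ∈ Ω)
  (hinj : Function.Injective (fderiv ℝ (coordinateMap F t l₂ l₃ L₁ L₂) x)) {v : Euc n}
include hx hinj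

theorem eigenProj_eq_zero_of_fderiv_coordinateMap₁
    (hv : (fderiv ℝ (coordinateMap F t l₂ l₃ L₁ L₂) x v).2.1 = 0) :
    eigenProj ε F τ l₂ l₃ x v = 0 := by
  have hmem := S.eigenProj_mem hx v
  refine hinj ?_
  rw [S.fderiv_coordinateMap ht hB h₁ h₂ hx] at hv ⊢
  have hfirst : Real.exp (-(l₂ * t x)) • L₁ (fderiv ℝ F x (eigenProj ε F τ l₂ l₃ x v)) = 0 := hv
  rw [S.orth₂ x hx _ hmem, S.eigenProj_of_mem hx hmem, S.swap.eigenProj_eq_zero_of_mem hx hmem,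
    hfirst]
  simp

theorem eigenProj_eq_zero_of_fderiv_coordinateMap₂
    (hv : (fderiv ℝ (coordinateMap F t l₂ l₃ L₁ L₂) x v).2.2 = 0) :
    eigenProj ε F τ l₃ l₂ x v = 0 := by
  have hmem := S.swap.eigenProj_mem hx v
  refine hinj ?_
  rw [S.fderiv_coordinateMap ht hB h₁ h₂ hx] at hv ⊢
  have hsecond : Real.exp (-(l₃ * t x)) • L₂ (fderiv ℝ F x (eigenProj ε F τ l₃ l₂ x v)) = 0 := hv
  rw [S.orth₃ x hx _ hmem, S.eigenProj_eq_zero_of_mem hx hmem, S.swap.eigenProj_of_mem hx hmem,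
    hsecond]
  simp

theorem exists_eq_smul_of_fderiv_coordinateMap {s : ℝ}
    (hv : fderiv ℝ (coordinateMap F t l₂ l₃ L₁ L₂) x v = (s, 0, 0)) : ∃ c : ℝ, v = c • τ x := by
  refine ⟨metric ε F x (τ x) v, ?_⟩
  conv_lhs => rw [S.eq_add_eigenProj hx v,
    S.eigenProj_eq_zero_of_fderiv_coordinateMap₁ ht hB h₁ h₂ hx hinj (by rw [hv]),
    S.eigenProj_eq_zero_of_fderiv_coordinateMap₂ ht hB h₁ h₂ hx hinj (by rw [hv]),
    add_zero, add_zero]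

theorem mem_of_fderiv_coordinateMap₁ {a : W₁}
    (hv : fderiv ℝ (coordinateMap F t l₂ l₃ L₁ L₂) x v = (0, a, 0)) : v ∈ D₂ x := by
  rw [S.eq_add_eigenProj hx v,
    S.metric_eq_zero_of_fderiv_coordinateMap ht hB h₁ h₂ hx (by rw [hv]),
    S.eigenProj_eq_zero_of_fderiv_coordinateMap₂ ht hB h₁ h₂ hx hinj (by rw [hv]),
    zero_smul, zero_add, add_zero]
  exact S.eigenProj_mem hx v

theorem mem_of_fderiv_coordinateMap₂ {b : W₂}
    (hv : fderiv ℝ (coordinateMap F t l₂ l₃ L₁ L₂) x v = (0, 0, b)) : v ∈ D₃ x := by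
  rw [S.eq_add_eigenProj hx v,
    S.metric_eq_zero_of_fderiv_coordinateMap ht hB h₁ h₂ hx (by rw [hv]),
    S.eigenProj_eq_zero_of_fderiv_coordinateMap₁ ht hB h₁ h₂ hx hinj (by rw [hv]),
    zero_smul, zero_add, zero_add]
  exact S.swap.eigenProj_mem hx v

end Kernels
end CoordinateMap

theorem isAdapted_of_coordinateMap {t : Euc n → ℝ}
    (ht : ∀ x ∈ Ω, HasFDerivAt t (metric ε F x (τ x)) x) {B : Euc (n + 1) →L[ℝ] Euc (n + 1)}
    (hB : Set.EqOn (imageField F τ) (B ∘ F) Ω) {L₁ : Euc (n + 1) →L[ℝ] Euc n₁}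
    (h₁ : ∀ z, L₁ (B z) = l₂ • L₁ z) {L₂ : Euc (n + 1) →L[ℝ] Euc n₂}
    (h₂ : ∀ z, L₂ (B z) = l₃ • L₂ z) {Ψ : OpenPartialHomeomorph (ℝ × Euc n₁ × Euc n₂) (Euc n)}
    {x : Euc n} {u₀ r : ℝ} {p₀ : Euc n₁} {q₀ : Euc n₂}
    (C : IsProductChart Ψ Ω x (Metric.ball u₀ r) (Metric.ball p₀ r) (Metric.ball q₀ r))
    (hright : ∀ z ∈ Ψ.source, coordinateMap F t l₂ l₃ L₁ L₂ (Ψ z) = z)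
    (hinj : ∀ z ∈ Ψ.source,
      Function.Injective (fderiv ℝ (coordinateMap F t l₂ l₃ L₁ L₂) (Ψ z))) :
    IsAdapted τ D₂ D₃ Ω Ψ (Metric.ball u₀ r) (Metric.ball p₀ r) (Metric.ball q₀ r) := by
  let Θ := coordinateMap F t l₂ l₃ L₁ L₂
  have hmaps : Set.MapsTo Ψ Ψ.source Ω := fun z hz => C.target_subset (Ψ.map_source hz)
  have hderiv : ∀ z ∈ Ψ.source, ∀ X, fderiv ℝ Θ (Ψ z) (fderiv ℝ Ψ z X) = X := fun z hz X => by
    have hΨ := hasFDerivAt_of_contDiffAt_infty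
      (C.smooth.contDiffAt (Ψ.open_source.mem_nhds hz))
    have hΘ := hasFDerivAt_of_contDiffAt_infty
      ((S.contDiffOn_coordinateMap ht L₁ L₂).contDiffAt (S.isOpen.mem_nhds (hmaps hz)))
    exact hasFDerivAt_unique_of_eqOn (hΘ.comp z hΨ) (hasFDerivAt_id z) Ψ.open_source hz hright X
  constructor
  case isOpen | isOpen₁ | isOpen₂ => exact Metric.isOpen_ball
  case preconnected | preconnected₁ | preconnected₂ => exact (convex_ball _ _).isPreconnected
  all_goals rw [← C.source_eq]
  case smooth => exact C.smooth
  case mapsTo => exact hmaps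
  case injective => exact fun z hz X hX => by rw [← hderiv z hz X, hX, map_zero]
  case time =>
    exact fun z hz s => S.exists_eq_smul_of_fderiv_coordinateMap ht hB h₁ h₂ (hmaps hz)
      (hinj z hz) (hderiv z hz (s, 0, 0))
  case first =>
    exact fun z hz v => S.mem_of_fderiv_coordinateMap₁ ht hB h₁ h₂ (hmaps hz) (hinj z hz)
      (hderiv z hz (0, v, 0))
  case second =>
    exact fun z hz w => S.mem_of_fderiv_coordinateMap₂ ht hB h₁ h₂ (hmaps hz) (hinj z hz)
      (hderiv z hz (0, 0, w))

theorem exists_isAdapted {x : Euc n} (hx : x ∈ Ω) {t : Euc n → ℝ}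
    (ht : ∀ x ∈ Ω, HasFDerivAt t (metric ε F x (τ x)) x) {B : Euc (n + 1) →L[ℝ] Euc (n + 1)}
    (hB : Set.EqOn (imageField F τ) (B ∘ F) Ω) {W₁ W₂ : Type*} [NormedAddCommGroup W₁]
    [NormedSpace ℝ W₁] [FiniteDimensional ℝ W₁] [NormedAddCommGroup W₂] [NormedSpace ℝ W₂]
    [FiniteDimensional ℝ W₂] {A₁ : Euc (n + 1) →L[ℝ] W₁} (hA₁ : IsEigenProjection B l₂ A₁)
    {A₂ : Euc (n + 1) →L[ℝ] W₂} (hA₂ : IsEigenProjection B l₃ A₂) :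
    ∃ (J : Set ℝ) (U₁ : Set (Euc n₁)) (U₂ : Set (Euc n₂))
      (Ψ : OpenPartialHomeomorph (ℝ × Euc n₁ × Euc n₂) (Euc n)),
      IsProductChart Ψ Ω x J U₁ U₂ ∧ IsAdapted τ D₂ D₃ Ω Ψ J U₁ U₂ ∧
      ∀ z ∈ Ψ.source, l₂ * t (Ψ z) = z.1 := by
  obtain ⟨L₁, h₁, hL₁⟩ := S.exists_transverse_functional hB hA₁ hx
  obtain ⟨L₂, h₂, hL₂⟩ := S.swap.exists_transverse_functional hB hA₂ hx
  obtain ⟨r, Ψ, C, hΨ⟩ := exists_isProductChart S.isOpen (S.contDiffOn_coordinateMap ht L₁ L₂) hx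
    (isInvertible_of_injective (S.injective_fderiv_coordinateMap ht hB h₁ h₂ hx hL₁ hL₂)
      (by simp [← S.dim, add_assoc]))
  exact ⟨_, _, _, Ψ, C, S.isAdapted_of_coordinateMap ht hB h₁ h₂ C (fun z hz => (hΨ z hz).1)
    fun z hz => (hΨ z hz).2.injective, fun z hz => congrArg Prod.fst (hΨ z hz).1⟩

end EigenSplitting

section Diagonalization

variable {V W₁ W₂ : Type*} [NormedAddCommGroup V] [NormedSpace ℝ V] [NormedAddCommGroup W₁]
  [NormedSpace ℝ W₁] [NormedAddCommGroup W₂] [NormedSpace ℝ W₂] {B : V →L[ℝ] V} {l₁ l₂ : ℝ}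

theorem IsEigenProjection.of_equiv (hl : l₁ ≠ l₂) (A : V ≃L[ℝ] W₁ × W₂)
    (hA : ∀ z, A (B z) = (l₁ • (A z).1, l₂ • (A z).2)) :
    IsEigenProjection B l₁ ((ContinuousLinearMap.fst ℝ W₁ W₂).comp (A : V →L[ℝ] W₁ × W₂)) where
  map z := congrArg Prod.fst (hA z)
  injective z hz hfst := by
    have hsnd : l₁ • (A z).2 = l₂ • (A z).2 := by
      rw [← Prod.smul_snd, ← map_smul, ← hz, hA]
    rw [← sub_eq_zero, ← sub_smul] at hsnd
    exact A.map_eq_zero_iff.1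
      (Prod.ext hfst ((smul_eq_zero.1 hsnd).resolve_left (sub_ne_zero.2 hl)))

end Diagonalization

namespace EigenSplitting

variable {ε : ℝ} {F : Euc n → Euc (n + 1)} {Ω : Set (Euc n)} {τ : Euc n → Euc n}
  {D₂ D₃ : Euc n → Submodule ℝ (Euc n)} {n₁ n₂ : ℕ} {l₁ l₂ l₃ : ℝ}
  (S : EigenSplitting ε F Ω τ D₂ D₃ n₁ n₂ l₁ l₂ l₃)
include S

theorem exists_isEigenProjections {x : Euc n} (hx : x ∈ Ω) {B : Euc (n + 1) →L[ℝ] Euc (n + 1)}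
    (hB : Set.EqOn (imageField F τ) (B ∘ F) Ω) :
    ∃ A : Euc (n + 1) ≃L[ℝ] Euc (n₁ + 1) × Euc (n₂ + 1),
      IsEigenProjection B l₂ ((ContinuousLinearMap.fst ℝ _ _).comp
        (A : Euc (n + 1) →L[ℝ] Euc (n₁ + 1) × Euc (n₂ + 1))) ∧
      IsEigenProjection B l₃ ((ContinuousLinearMap.snd ℝ _ _).comp
        (A : Euc (n + 1) →L[ℝ] Euc (n₁ + 1) × Euc (n₂ + 1))) := by
  have hdim : n + 1 = n₁ + 1 + (n₂ + 1) := by have := S.dim; lia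
  obtain ⟨e, he⟩ := exists_equiv_prod_of_eigenspaces (W₁ := Euc (n₁ + 1)) (W₂ := Euc (n₂ + 1))
    (B : Module.End ℝ (Euc (n + 1))) S.ne₂₃ (by simpa using hdim)
    (by simpa using S.add_one_le_finrank_eigenspace hx hB)
    (by simpa using S.swap.add_one_le_finrank_eigenspace hx hB)
  let A := e.toContinuousLinearEquiv
  exact ⟨A, .of_equiv S.ne₂₃ A he,
    .of_equiv S.ne₂₃.symm (A.trans (ContinuousLinearEquiv.prodComm ℝ _ _))
      fun z => congrArg Prod.swap (he z)⟩

theorem exists_calabi_coordinates (hΩ : Convex ℝ Ω) {x : Euc n} (hx : x ∈ Ω) :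
    ∃ (J : Set ℝ) (U₁ : Set (Euc n₁)) (U₂ : Set (Euc n₂)) (G₁ : Euc n₁ → Euc (n₁ + 1))
      (G₂ : Euc n₂ → Euc (n₂ + 1)) (ε₁ ε₂ : ℝ)
      (A : Euc (n + 1) ≃L[ℝ] Euc (n₁ + 1) × Euc (n₂ + 1))
      (Ψ : OpenPartialHomeomorph (ℝ × Euc n₁ × Euc n₂) (Euc n)), IsOpen J ∧
      ParallelConvexParam ε₁ G₁ U₁ ∧ ParallelConvexParam ε₂ G₂ U₂ ∧
      IsProductChart Ψ Ω x J U₁ U₂ ∧ ∀ u ∈ J, ∀ p ∈ U₁, ∀ q ∈ U₂,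
        A (F (Ψ (u, p, q))) = calabiProduct (-(l₃ / l₂)) G₁ G₂ u p q := by
  obtain ⟨B, hB⟩ := S.exists_endomorphism hΩ
  obtain ⟨t, ht⟩ := S.exists_potential hΩ
  obtain ⟨A, hA₁, hA₂⟩ := S.exists_isEigenProjections hx hB
  obtain ⟨J, U₁, U₂, Ψ, C, P, htime⟩ := S.exists_isAdapted hx ht hB hA₁ hA₂
  obtain ⟨u₀, p₀, q₀, hu₀, hp₀, hq₀⟩ : ∃ u₀ p₀ q₀, u₀ ∈ J ∧ p₀ ∈ U₁ ∧ q₀ ∈ U₂ :=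
    ⟨_, _, _, C.source_eq ▸ Ψ.map_target C.mem_target⟩
  obtain ⟨ε₁, h₁⟩ := (P.isLeaf hu₀ hq₀).exists_parallelConvexParam_image S hx hB
    (hA₁.smul (Real.exp_ne_zero (-u₀)))
  obtain ⟨ε₂, h₂⟩ := (P.swap.isLeaf hu₀ hp₀).exists_parallelConvexParam_image S.swap hx hB
    (hA₂.smul (Real.exp_ne_zero (-(l₃ / l₂ * u₀))))
  refine ⟨J, U₁, U₂, _, _, ε₁, ε₂, A, Ψ, P.isOpen, h₁, h₂, C, fun u hu p hp q hq => ?_⟩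
  have hfirst : ∀ u ∈ J, ∀ p ∈ U₁, ∀ q ∈ U₂, l₂ * t (Ψ (u, p, q)) = u :=
    fun u hu p hp q hq => htime _ (C.source_eq ▸ ⟨hu, hp, hq⟩)
  have hsecond : ∀ u ∈ J, ∀ p ∈ U₁, ∀ q ∈ U₂, l₃ * t (Ψ (u, p, q)) = l₃ / l₂ * u :=
    fun u hu p hp q hq => by
      conv_rhs => rw [← hfirst u hu p hp q hq, ← mul_assoc,
        div_mul_cancel₀ _ (S.eigenvalue_ne_zero hx)]
  have hcomp₁ := P.component_eq S hB ht hA₁.map hu hu₀ hp hq hq₀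
  have hcomp₂ := P.swap.component_eq S.swap hB ht hA₂.map hu hu₀ hq hp hp₀
  simp only [component, hfirst u hu p hp q hq, hfirst u₀ hu₀ p hp q₀ hq₀, hsecond u hu p hp q hq,
    hsecond u₀ hu₀ p₀ hp₀ q hq] at hcomp₁ hcomp₂
  rw [Real.exp_neg, inv_smul_eq_iff₀ (Real.exp_ne_zero _)] at hcomp₁ hcomp₂
  refine Prod.ext hcomp₁ ?_
  rw [calabiProduct, neg_neg]
  exact hcomp₂

end EigenSplitting
end CalabiCoordinates

/-! ### Passage to the manifold -/

section Germs

variable {n : ℕ} {ε : ℝ} {F G : Euc n → Euc (n + 1)} {x : Euc n}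

theorem metric_congr (h : F =ᶠ[nhds x] G) : metric ε F x = metric ε G x := by
  simp only [metric, gaussFrame, h.eq_of_nhds, h.fderiv_eq, h.fderiv.fderiv_eq]

theorem inducedConnection_congr (h : F =ᶠ[nhds x] G) :
    inducedConnection ε F x = inducedConnection ε G x := by
  simp only [inducedConnection, gaussFrame, h.eq_of_nhds, h.fderiv_eq, h.fderiv.fderiv_eq]

theorem metric_eventuallyEq (h : F =ᶠ[nhds x] G) : metric ε F =ᶠ[nhds x] metric ε G :=
  h.eventuallyEq_nhds.mono fun _ => metric_congr

theorem metricConnection_congr (h : F =ᶠ[nhds x] G) (u v : Euc n) :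
    metricConnection ε F x u v = metricConnection ε G x u v := by
  simp only [metricConnection, leviCivita, metric_congr h, (metric_eventuallyEq h).fderiv_eq]

theorem cubicForm_congr (h : F =ᶠ[nhds x] G) (u v w : Euc n) :
    cubicForm ε F x u v w = cubicForm ε G x u v w := by
  have hmetric : (fun y => metric ε F y v w) =ᶠ[nhds x] fun y => metric ε G y v w :=
    (metric_eventuallyEq h).fun_comp fun g => g v w
  simp only [cubicForm, metric_congr h, inducedConnection_congr h, hmetric.fderiv_eq]

theorem covDerivCubicForm_congr (h : F =ᶠ[nhds x] G) (u v w z : Euc n) :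
    covDerivCubicForm ε F x u v w z = covDerivCubicForm ε G x u v w z := by
  have hcubic : (fun y => cubicForm ε F y v w z) =ᶠ[nhds x] fun y => cubicForm ε G y v w z :=
    h.eventuallyEq_nhds.mono fun y hy => cubicForm_congr hy v w z
  simp only [covDerivCubicForm, cubicForm_congr h, metricConnection_congr h, hcubic.fderiv_eq]

end Germs

theorem isInvertible_gaussFrame_iff {n : ℕ} {ε : ℝ} (hε : ε ≠ 0) {f : Euc n → Euc (n + 1)}
    {x : Euc n} : (gaussFrame ε f x).IsInvertible ↔
      Function.Injective (fderiv ℝ f x) ∧ f x ∉ Set.range (fderiv ℝ f x) := by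
  constructor
  · refine fun h => ⟨fun v w hvw => congrArg Prod.fst (h.injective (a₁ := (v, 0)) (a₂ := (w, 0))
      (by simpa only [gaussFrame_apply_zero] using hvw)), ?_⟩
    rintro ⟨v, hv⟩
    have hzero : (v, ε⁻¹) = (0 : Euc n × ℝ) := h.injective <| by
      rw [gaussFrame_apply, hv, smul_neg, inv_smul_smul₀ hε, add_neg_cancel, map_zero]
    exact inv_ne_zero hε (congrArg Prod.snd hzero)
  · rintro ⟨hinj, htrans⟩
    refine isInvertible_gaussFrame fun v c h => ?_
    rw [gaussFrame_apply, smul_neg, ← sub_eq_add_neg, sub_eq_zero, smul_smul] at h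
    have hc : c = 0 := by
      by_contra hc
      refine htrans ⟨(c * ε)⁻¹ • v, ?_⟩
      rw [map_smul, h, inv_smul_smul₀ (mul_ne_zero hc hε)]
    rw [hc, zero_mul, zero_smul] at h
    exact ⟨(injective_iff_map_eq_zero _).1 hinj v h, hc⟩

section OpenDomains

open TopologicalSpace (Opens)

variable {m : ℕ} {U : Opens (Euc m)}

theorem opens_chart_coe {e : OpenPartialHomeomorph U (Euc m)} (he : e ∈ atlas (Euc m) U) (p : U) :
    e p = p := by
  obtain ⟨x, rfl⟩ := Opens.chart_eq ⟨p⟩ he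
  rfl

theorem opens_chart_symm {e : OpenPartialHomeomorph U (Euc m)} (he : e ∈ atlas (Euc m) U)
    {y : Euc m} (hy : y ∈ e.target) : (e.symm y : Euc m) = y := by
  rw [← opens_chart_coe he, e.right_inv hy]

theorem opens_chart_target_subset {e : OpenPartialHomeomorph U (Euc m)}
    (he : e ∈ atlas (Euc m) U) : e.target ⊆ U := fun _ hy =>
  opens_chart_symm he hy ▸ (e.symm _).2

theorem restrict_comp_chart_symm_eventuallyEq {α : Type*} (G : Euc m → α)
    {e : OpenPartialHomeomorph U (Euc m)} (he : e ∈ atlas (Euc m) U) {y : Euc m}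
    (hy : y ∈ e.target) : (fun p : U => G p) ∘ e.symm =ᶠ[nhds y] G := by
  filter_upwards [e.open_target.mem_nhds hy] with z hz
  simp only [Function.comp_apply, opens_chart_symm he hz]

theorem mfderiv_subtype_val_injective (p : U) :
    Function.Injective (mfderiv (𝓡 m) (𝓡 m) (Subtype.val : U → Euc m) p) := by
  have hchart : (chartAt (Euc m) p : U → Euc m) = Subtype.val :=
    funext (opens_chart_coe (chart_mem_atlas (Euc m) p))
  rw [← hchart]
  exact (mdifferentiable_chart (I := 𝓡 m) p).mfderiv_injective (mem_chart_source (Euc m) p)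

theorem mfderiv_restrict {k : ℕ} {G : Euc m → Euc k} {p : U} (hG : DifferentiableAt ℝ G p) :
    mfderiv (𝓡 m) (𝓡 k) (fun p : U => G p) p =
      (fderiv ℝ G p).comp (mfderiv (𝓡 m) (𝓡 m) (Subtype.val : U → Euc m) p) := by
  rw [← mfderiv_eq_fderiv]
  exact mfderiv_comp p (g := G) (f := (Subtype.val : U → Euc m)) hG.mdifferentiableAt
    ((contMDiff_subtype_val (n := 1)).mdifferentiable (by simp) p)

variable {ε : ℝ} {G : Euc m → Euc (m + 1)}

theorem ConvexParam.isCentroaffine (H : ConvexParam ε G (U : Set (Euc m))) :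
    IsCentroaffine (fun p : U => G p) := by
  have hmf (p : U) := mfderiv_restrict (G := G) (p := p) (H.hasFDerivAt p.2).differentiableAt
  have hframe (p : U) := (isInvertible_gaussFrame_iff (H.sign_ne_zero p.2)).1 (H.frame p p.2)
  refine ⟨fun p => ?_, fun p => ?_, fun p => ?_⟩
  · exact (H.contDiffAt p.2).contMDiffAt.comp p contMDiff_subtype_val.contMDiffAt
  · rw [hmf p]
    exact (hframe p).1.comp (mfderiv_subtype_val_injective p)
  · rw [hmf p]
    rintro ⟨v, hv⟩
    exact (hframe p).2 ⟨_, hv⟩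

theorem ParallelConvexParam.isLocallyStronglyConvex
    (H : ParallelConvexParam ε G (U : Set (Euc m))) :
    IsLocallyStronglyConvex ε (fun p : U => G p) where
  centroaffine := H.isCentroaffine
  sign := H.sign
  pos e he y hy v hv := by
    rw [metric_congr (restrict_comp_chart_symm_eventuallyEq G he hy)]
    exact H.pos y (opens_chart_target_subset he hy) v hv

theorem ParallelConvexParam.hasParallelCubicForm
    (H : ParallelConvexParam ε G (U : Set (Euc m))) :
    HasParallelCubicForm ε (fun p : U => G p) := fun e he y hy u v w z => by
  rw [covDerivCubicForm_congr (restrict_comp_chart_symm_eventuallyEq G he hy)]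
  exact H.parallel y (opens_chart_target_subset he hy) u v w z

end OpenDomains

section Charts

variable {n : ℕ} {M : Type*} [TopologicalSpace M] [ChartedSpace (Euc n) M]
  {e : OpenPartialHomeomorph M (Euc n)}

/-- The chart expression of a distribution. -/
noncomputable def chartDistribution (e : OpenPartialHomeomorph M (Euc n))
    (D : (p : M) → Submodule ℝ (TangentSpace (𝓡 n) p)) (y : Euc n) : Submodule ℝ (Euc n) :=
  (D (e.symm y)).map (mfderiv (𝓡 n) (𝓡 n) e (e.symm y)).toLinearMap

theorem metric_chart_symm {ε : ℝ} (ψ : M → Euc (n + 1)) {y : Euc n} (hy : y ∈ e.target)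
    (v w : TangentSpace (𝓡 n) (e.symm y)) :
    metric ε (ψ ∘ e.symm) y (mfderiv (𝓡 n) (𝓡 n) e (e.symm y) v)
      (mfderiv (𝓡 n) (𝓡 n) e (e.symm y) w) = metricAt ε ψ e (e.symm y) v w := by
  rw [metricAt, e.right_inv hy]

theorem difference_chart_symm {ε : ℝ} {ψ : M → Euc (n + 1)} {y : Euc n} (hy : y ∈ e.target)
    {v w z : TangentSpace (𝓡 n) (e.symm y)}
    (h : DifferenceTensorEq ε ψ e (e.symm y) v w z) :
    difference ε (ψ ∘ e.symm) y (mfderiv (𝓡 n) (𝓡 n) e (e.symm y) v)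
      (mfderiv (𝓡 n) (𝓡 n) e (e.symm y) w) = mfderiv (𝓡 n) (𝓡 n) e (e.symm y) z := by
  rw [DifferenceTensorEq, e.right_inv hy] at h
  exact (difference_apply ε _ y _ _).trans h

variable [IsManifold (𝓡 n) ∞ M]

theorem contMDiffOn_chart (he : e ∈ atlas (Euc n) M) : ContMDiffOn (𝓡 n) (𝓡 n) ∞ e e.source :=
  contMDiffOn_of_mem_maximalAtlas (IsManifold.subset_maximalAtlas he)

theorem contMDiffOn_chart_symm (he : e ∈ atlas (Euc n) M) :
    ContMDiffOn (𝓡 n) (𝓡 n) ∞ e.symm e.target :=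
  contMDiffOn_symm_of_mem_maximalAtlas (IsManifold.subset_maximalAtlas he)

theorem mdifferentiable_chart_of_mem_atlas (he : e ∈ atlas (Euc n) M) :
    e.MDifferentiable (𝓡 n) (𝓡 n) :=
  have : IsManifold (𝓡 n) 1 M := .of_le (n := ∞) (by simp)
  mdifferentiable_of_mem_atlas he

theorem fderiv_comp_chart_symm {k : ℕ} {ψ : M → Euc k} (he : e ∈ atlas (Euc n) M) {y : Euc n}
    (hy : y ∈ e.target) (hψ : MDifferentiableAt (𝓡 n) (𝓡 k) ψ (e.symm y)) :
    fderiv ℝ (ψ ∘ e.symm) y =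
      (mfderiv (𝓡 n) (𝓡 k) ψ (e.symm y)).comp (mfderiv (𝓡 n) (𝓡 n) e.symm y) := by
  rw [← mfderiv_eq_fderiv]
  exact mfderiv_comp y hψ ((mdifferentiable_chart_of_mem_atlas he).mdifferentiableAt_symm hy)

theorem IsLocallyStronglyConvex.convexParam {ε : ℝ} {ψ : M → Euc (n + 1)}
    (hψ : IsLocallyStronglyConvex ε ψ) (he : e ∈ atlas (Euc n) M) :
    ConvexParam ε (ψ ∘ e.symm) e.target where
  isOpen := e.open_target
  smooth := contMDiffOn_iff_contDiffOn.1
    (hψ.centroaffine.smooth.comp_contMDiffOn (contMDiffOn_chart_symm he))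
  pos := hψ.pos e he
  frame y hy := by
    have hε : ε ≠ 0 := by rcases hψ.sign with h | h <;> simp [h]
    have hfderiv := fderiv_comp_chart_symm he hy
      (hψ.centroaffine.smooth.mdifferentiable (by simp) (e.symm y))
    rw [isInvertible_gaussFrame_iff hε, hfderiv]
    refine ⟨(hψ.centroaffine.immersion _).comp
      ((mdifferentiable_chart_of_mem_atlas he).symm.mfderiv_injective hy), ?_⟩
    rintro ⟨v, hv⟩
    exact hψ.centroaffine.transversal (e.symm y) ⟨_, hv⟩

theorem contDiffOn_chart_field {T : (p : M) → TangentSpace (𝓡 n) p}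
    (hT : ContMDiff (𝓡 n) (𝓡 n).tangent ∞ (fun p => (⟨p, T p⟩ : TangentBundle (𝓡 n) M)))
    (he : e ∈ atlas (Euc n) M) :
    ContDiffOn ℝ ∞ (fun y => (mfderiv (𝓡 n) (𝓡 n) e (e.symm y) (T (e.symm y)) : Euc n))
      e.target := by
  have htangent := (contMDiffOn_chart he).contMDiffOn_tangentMapWithin (m := ∞) (by simp)
    e.open_source.uniqueMDiffOn
  have hfield := (contMDiff_snd_tangentBundle_modelSpace (Euc n) (𝓡 n) (n := ∞)).comp_contMDiffOn
    (htangent.comp (hT.comp_contMDiffOn (contMDiffOn_chart_symm he)) fun y hy => e.map_target hy)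
  refine (contMDiffOn_iff_contDiffOn.1 hfield).congr fun y hy => ?_
  have hwithin := mfderivWithin_of_isOpen (I := 𝓡 n) (I' := 𝓡 n) (f := e) e.open_source
    (e.map_target hy)
  exact congrArg (fun L => L (T (e.symm y))) hwithin.symm

theorem finrank_chartDistribution (he : e ∈ atlas (Euc n) M)
    (D : (p : M) → Submodule ℝ (TangentSpace (𝓡 n) p)) {y : Euc n} (hy : y ∈ e.target) :
    Module.finrank ℝ (chartDistribution e D y) = Module.finrank ℝ (D (e.symm y)) :=
  (Submodule.equivMapOfInjective _ ((mdifferentiable_chart_of_mem_atlas he).mfderiv_injective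
    (e.map_target hy)) (D (e.symm y))).finrank_eq.symm

theorem eigenSplitting_chart {n₁ n₂ : ℕ} (hn : 1 + n₁ + n₂ = n) (hn₁ : 1 ≤ n₁) (hn₂ : 1 ≤ n₂)
    {ε : ℝ} {ψ : M → Euc (n + 1)} (hψ : IsLocallyStronglyConvex ε ψ)
    (hK : HasParallelDifferenceTensor ε ψ) {T : (p : M) → TangentSpace (𝓡 n) p}
    (hT : ContMDiff (𝓡 n) (𝓡 n).tangent ∞ (fun p => (⟨p, T p⟩ : TangentBundle (𝓡 n) M)))
    {D₂ D₃ : (p : M) → Submodule ℝ (TangentSpace (𝓡 n) p)}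
    (hD₂ : ∀ p, Module.finrank ℝ (D₂ p) = n₁) (hD₃ : ∀ p, Module.finrank ℝ (D₃ p) = n₂)
    {l₁ l₂ l₃ : ℝ} (h₁₂ : l₁ ≠ 2 * l₂) (h₁₃ : l₁ ≠ 2 * l₃) (h₂₃ : l₂ ≠ l₃)
    (he : e ∈ atlas (Euc n) M)
    (hTT : ∀ p ∈ e.source, metricAt ε ψ e p (T p) (T p) = 1)
    (hTV : ∀ p ∈ e.source, ∀ V ∈ D₂ p, metricAt ε ψ e p (T p) V = 0)
    (hTW : ∀ p ∈ e.source, ∀ W ∈ D₃ p, metricAt ε ψ e p (T p) W = 0)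
    (hVW : ∀ p ∈ e.source, ∀ V ∈ D₂ p, ∀ W ∈ D₃ p, metricAt ε ψ e p V W = 0)
    (hK₁ : ∀ p ∈ e.source, DifferenceTensorEq ε ψ e p (T p) (T p) (l₁ • T p))
    (hK₂ : ∀ p ∈ e.source, ∀ V ∈ D₂ p, DifferenceTensorEq ε ψ e p (T p) V (l₂ • V))
    (hK₃ : ∀ p ∈ e.source, ∀ W ∈ D₃ p, DifferenceTensorEq ε ψ e p (T p) W (l₃ • W)) :
    EigenSplitting ε (ψ ∘ e.symm) e.target
      (fun y => (mfderiv (𝓡 n) (𝓡 n) e (e.symm y) (T (e.symm y)) : Euc n))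
      (chartDistribution e D₂) (chartDistribution e D₃) n₁ n₂ l₁ l₂ l₃ where
  toConvexParam := hψ.convexParam he
  parallel := hK e he
  smooth_field := contDiffOn_chart_field hT he
  dim := hn
  pos₁ := hn₁
  pos₂ := hn₂
  finrank₂ _ hy := (finrank_chartDistribution he D₂ hy).trans (hD₂ _)
  finrank₃ _ hy := (finrank_chartDistribution he D₃ hy).trans (hD₃ _)
  unit _ hy := (metric_chart_symm ψ hy _ _).trans (hTT _ (e.map_target hy))
  orth₂ := by
    rintro y hy _ ⟨V, hV, rfl⟩
    exact (metric_chart_symm ψ hy _ _).trans (hTV _ (e.map_target hy) V hV)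
  orth₃ := by
    rintro y hy _ ⟨W, hW, rfl⟩
    exact (metric_chart_symm ψ hy _ _).trans (hTW _ (e.map_target hy) W hW)
  orth₂₃ := by
    rintro y hy _ ⟨V, hV, rfl⟩ _ ⟨W, hW, rfl⟩
    exact (metric_chart_symm ψ hy _ _).trans (hVW _ (e.map_target hy) V hV W hW)
  eigen₁ _ hy := (difference_chart_symm hy (hK₁ _ (e.map_target hy))).trans (map_smul _ _ _)
  eigen₂ := by
    rintro y hy _ ⟨V, hV, rfl⟩
    exact (difference_chart_symm hy (hK₂ _ (e.map_target hy) V hV)).trans (map_smul _ _ _)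
  eigen₃ := by
    rintro y hy _ ⟨W, hW, rfl⟩
    exact (difference_chart_symm hy (hK₃ _ (e.map_target hy) W hW)).trans (map_smul _ _ _)
  ne₁₂ := h₁₂
  ne₁₃ := h₁₃
  ne₂₃ := h₂₃

theorem EigenSplitting.isCalabiProductNear {ε : ℝ} {ψ : M → Euc (n + 1)} {x : M}
    {τ : Euc n → Euc n} {D₂ D₃ : Euc n → Submodule ℝ (Euc n)} {n₁ n₂ : ℕ} {l₁ l₂ l₃ : ℝ}
    (S : EigenSplitting ε (ψ ∘ (chartAt (Euc n) x).symm) (chartAt (Euc n) x).target τ D₂ D₃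
      n₁ n₂ l₁ l₂ l₃) : IsCalabiProductNear n₁ n₂ (-(l₃ / l₂)) ψ x := by
  set e := chartAt (Euc n) x
  have he : e ∈ atlas (Euc n) M := chart_mem_atlas _ _
  have hx : x ∈ e.source := mem_chart_source _ x
  obtain ⟨ρ, hρ, hball⟩ := Metric.isOpen_iff.1 e.open_target (e x) (e.map_source hx)
  obtain ⟨J, U₁, U₂, G₁, G₂, ε₁, ε₂, A, Ψ, hJ, H₁, H₂, C, hcalabi⟩ :=
    (S.mono Metric.isOpen_ball hball).exists_calabi_coordinates (convex_ball _ _)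
      (Metric.mem_ball_self hρ)
  have hmaps : Set.MapsTo Ψ Ψ.source e.target := fun z hz =>
    hball (C.target_subset (Ψ.map_source hz))
  have hsource : (Ψ.trans e.symm).source = Ψ.source := by
    rw [OpenPartialHomeomorph.trans_source]
    exact Set.inter_eq_left.2 hmaps
  have htarget : (Ψ.trans e.symm).target = e.source ∩ e ⁻¹' Ψ.target :=
    OpenPartialHomeomorph.trans_target _ _
  have H₁' : ParallelConvexParam ε₁ G₁ (⟨U₁, H₁.isOpen⟩ : TopologicalSpace.Opens _) := H₁
  have H₂' : ParallelConvexParam ε₂ G₂ (⟨U₂, H₂.isOpen⟩ : TopologicalSpace.Opens _) := H₂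
  refine ⟨⟨J, hJ⟩, ⟨U₁, H₁.isOpen⟩, ⟨U₂, H₂.isOpen⟩, fun p => G₁ p, fun q => G₂ q, ε₁, ε₂, A,
    Ψ.trans e.symm, H₁'.isLocallyStronglyConvex, H₁'.hasParallelCubicForm,
    H₂'.isLocallyStronglyConvex, H₂'.hasParallelCubicForm, ?_, ?_, ?_,
    hsource.trans C.source_eq, fun u hu p q => hcalabi u hu p p.2 q q.2⟩
  · rw [hsource]
    exact (contMDiffOn_chart_symm he).comp (contMDiffOn_iff_contDiffOn.2 C.smooth) hmaps
  · rw [htarget]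
    exact (contMDiffOn_iff_contDiffOn.2 C.smooth_symm).comp
      ((contMDiffOn_chart he).mono Set.inter_subset_left) fun _ hp => hp.2
  · rw [htarget]
    exact ⟨hx, C.mem_target⟩

end Charts

end Centroaffine

theorem theorem3p2 {n n₁ n₂ : ℕ} (hn : 1 + n₁ + n₂ = n) (hn₁ : 1 ≤ n₁) (hn₂ : 1 ≤ n₂)
    {M : Type*} [TopologicalSpace M] [ChartedSpace (Centroaffine.Euc n) M] [IsManifold (𝓡 n) ∞ M]
    (ε : ℝ) (ψ : M → Centroaffine.Euc (n + 1))
    (hψ : Centroaffine.IsLocallyStronglyConvex ε ψ)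
    (hK : Centroaffine.HasParallelDifferenceTensor ε ψ)
    (T : (p : M) → TangentSpace (𝓡 n) p)
    (hT : ContMDiff (𝓡 n) (𝓡 n).tangent ∞ (fun p => (⟨p, T p⟩ : TangentBundle (𝓡 n) M)))
    (D₂ D₃ : (p : M) → Submodule ℝ (TangentSpace (𝓡 n) p))
    (hD₂ : ∀ p, Module.finrank ℝ (D₂ p) = n₁) (hD₃ : ∀ p, Module.finrank ℝ (D₃ p) = n₂)
    (hTT : ∀ e ∈ atlas (Centroaffine.Euc n) M, ∀ p ∈ e.source,
      Centroaffine.metricAt ε ψ e p (T p) (T p) = 1)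
    (hTV : ∀ e ∈ atlas (Centroaffine.Euc n) M, ∀ p ∈ e.source, ∀ V ∈ D₂ p,
      Centroaffine.metricAt ε ψ e p (T p) V = 0)
    (hTW : ∀ e ∈ atlas (Centroaffine.Euc n) M, ∀ p ∈ e.source, ∀ W ∈ D₃ p,
      Centroaffine.metricAt ε ψ e p (T p) W = 0)
    (hVW : ∀ e ∈ atlas (Centroaffine.Euc n) M, ∀ p ∈ e.source, ∀ V ∈ D₂ p, ∀ W ∈ D₃ p,
      Centroaffine.metricAt ε ψ e p V W = 0)
    (l₁ l₂ l₃ : ℝ)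
    (hK₁ : ∀ e ∈ atlas (Centroaffine.Euc n) M, ∀ p ∈ e.source,
      Centroaffine.DifferenceTensorEq ε ψ e p (T p) (T p) (l₁ • T p))
    (hK₂ : ∀ e ∈ atlas (Centroaffine.Euc n) M, ∀ p ∈ e.source, ∀ V ∈ D₂ p,
      Centroaffine.DifferenceTensorEq ε ψ e p (T p) V (l₂ • V))
    (hK₃ : ∀ e ∈ atlas (Centroaffine.Euc n) M, ∀ p ∈ e.source, ∀ W ∈ D₃ p,
      Centroaffine.DifferenceTensorEq ε ψ e p (T p) W (l₃ • W))
    (h₁₂ : l₁ ≠ 2 * l₂) (h₁₃ : l₁ ≠ 2 * l₃) (h₂₃ : l₂ ≠ l₃) :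
    ∃ lam : ℝ, lam ≠ 0 ∧ lam ≠ -1 ∧
      ∀ x : M, Centroaffine.IsCalabiProductNear n₁ n₂ lam ψ x := by
  have S := fun x : M => Centroaffine.eigenSplitting_chart hn hn₁ hn₂ hψ hK hT hD₂ hD₃ h₁₂ h₁₃ h₂₃
    (chart_mem_atlas (Centroaffine.Euc n) x) (hTT _ (chart_mem_atlas _ x))
    (hTV _ (chart_mem_atlas _ x)) (hTW _ (chart_mem_atlas _ x)) (hVW _ (chart_mem_atlas _ x))
    (hK₁ _ (chart_mem_atlas _ x)) (hK₂ _ (chart_mem_atlas _ x)) (hK₃ _ (chart_mem_atlas _ x))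
  rcases isEmpty_or_nonempty M with hM | ⟨⟨x⟩⟩
  · exact ⟨1, one_ne_zero, by norm_num, fun x => (hM.false x).elim⟩
  · have hx := mem_chart_target (Centroaffine.Euc n) x
    have hl₂ := (S x).eigenvalue_ne_zero hx
    have hl₃ := (S x).swap.eigenvalue_ne_zero hx
    refine ⟨-(l₃ / l₂), neg_ne_zero.2 (div_ne_zero hl₃ hl₂), fun h => h₂₃ ?_,
      fun y => (S y).isCalabiProductNear⟩
    rw [neg_inj, div_eq_one_iff_eq hl₂] at h
    exact h.symm
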